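/- Let $J$ be a real symmetric positive definite $3\times 3$ matrix (the inertia matrix), let $e_3=(0,0,1)^T$, and for $a\in\mathbb{R}^3$ let $\hat a$ be the skew-symmetric matrix with $\hat a b=a\times b$. For $\theta\in S^1=\mathbb{R}/2\pi\mathbb{Z}$ and $R\in SO(3)$ put $\Phi_\theta(R)=\exp(\theta\hat e_3)R$, the rotation of $R$ by $\theta$ about the vertical axis. Let $T>0$, and let $R:[0,T]\to SO(3)$ be a differentiable attitude motion with body angular velocity $\omega$, i.e. $\dot R=R\hat\omega$, along which the vertical angular momentum vanishes: $\mu=e_3^TR(t)J\omega(t)=0$ for all $t\in[0,T]$. (Every motion of the 3D pendulum with inertia matrix $J$ and $\mu=0$ is of this kind.) Suppose that its reduced curve $\Gamma(t)=R(t)^Te_3\in S^2$ is closed, $\Gamma(0)=\Gamma(T)$. Then there is exactly one $\theta_{\mathrm{geo}}\in S^1$ with $R(T)=\Phi_{\theta_{\mathrm{geo}}}(R(0))$ (the geometric phase), and for every spanning surface $\mathcal B$ of $\Gamma$ in $S^2$, $$\theta_{\mathrm{geo}}=\int_{\mathcal B}\frac{2\|J\Gamma\|^2-\operatorname{tr}(J)\,(\Gamma\cdot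 J\Gamma)}{(\Gamma\cdot J\Gamma)^2}\,dA \pmod{2\pi},$$ where in the integrand $\Gamma$ denotes the variable point of $\mathcal B$. Here a spanning surface is a parametrized disc $\sigma:[0,1]^2\to S^2$ of class $C^2$ in polar coordinates $(s,t)$, with boundary $\Gamma$: $\sigma(0,t)$ is independent of $t$, $\sigma(s,0)=\sigma(s,1)$, and $\sigma(1,t)=\Gamma(Tt)$. The curve $\Gamma$ may have self-intersections and $\sigma$ may overlap itself; $dA$ is the area form of $S^2$ oriented by the outward normal, so that the integral over $\sigma$ of a function $f$ is $\int_0^1\!\int_0^1 f(\sigma)\,\sigma\cdot(\partial_s\sigma\times\partial_t\sigma)\,ds\,dt$. If moreover $\sigma$ is injective on $(0,1)^2$ with $\sigma\cdot(\partial_s\sigma\times\partial_t\sigma)\ge 0$ there (so that $\Gamma$ runs counterclockwise around $\mathcal B=\sigma([0,1]^2)\subset S^2$, seen from outside), the same formula holds with $\int_{\mathcal B}\cdots\,dA$ the integral over the set $\mathcal B$ with respect to the surface area measure of $S^2$. -/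

import Mathlib

open Matrix MeasureTheory Set

noncomputable section

namespace Pendulum3D

/-- Vectors of `ℝ³`. The Euclidean structure is the one given by the dot product `⬝ᵥ` and the cross
product `⨯₃`; in particular the squared Euclidean norm of `v` is `v ⬝ᵥ v`. -/
abbrev Vec : Type := Fin 3 → ℝ

/-- Real `3 × 3` matrices. -/
abbrev Mat : Type := Matrix (Fin 3) (Fin 3) ℝ

/-- The vertical direction of the inertial frame. -/
def e3 : Vec := ![0, 0, 1]

/-- The skew-symmetric matrix of `a`, for which `hat a *ᵥ b = a ⨯₃ b`. -/
def hat (a : Vec) : Mat :=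
  !![0, -a 2, a 1; a 2, 0, -a 0; -a 1, a 0, 0]

theorem hat_mulVec (a b : Vec) : hat a *ᵥ b = a ⨯₃ b := by
  ext i
  fin_cases i <;> simp [hat, cross_apply, Matrix.mulVec, dotProduct, Fin.sum_univ_three] <;> ring

/-- The action of the circle on attitudes: `Φ_θ(R) = exp(θ ê₃) R`, the rotation by `θ` about the
vertical axis. -/
def verticalRotation (θ : ℝ) (R : Mat) : Mat :=
  NormedSpace.exp (θ • hat e3) * R

/-- The projection `Π(R) = Rᵀ e₃` of an attitude to the unit sphere. -/
def reducedAttitude (R : Mat) : Vec := Rᵀ *ᵥ e3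

/-- The momentum map `e₃ᵀ R J ω`, the vertical component of the angular momentum. -/
def momentumMap (J R : Mat) (ω : Vec) : ℝ := e3 ⬝ᵥ (R *ᵥ (J *ᵥ ω))

/-- `R` is, on `[0, T]`, a curve in `SO(3)` with body angular velocity `ω`, that is `Ṙ = R ω̂`
(one-sided derivatives at the end points; the derivative of a matrix is taken entrywise). -/
structure IsAttitudeMotion (T : ℝ) (R : ℝ → Mat) (ω : ℝ → Vec) : Prop where
  mem_SO3 : ∀ t ∈ Icc 0 T, R t ∈ Matrix.specialOrthogonalGroup (Fin 3) ℝ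
  kinematics : ∀ t ∈ Icc 0 T, ∀ i j,
    HasDerivWithinAt (fun τ => R τ i j) ((R t * hat (ω t)) i j) (Icc 0 T) t

/-- `θ ∈ S¹ = ℝ / 2πℤ` satisfies `R(T) = Φ_θ(R(0))`. -/
def IsRotationAngle (T : ℝ) (R : ℝ → Mat) (θ : Real.Angle) : Prop :=
  ∃ x : ℝ, (x : Real.Angle) = θ ∧ R T = verticalRotation x (R 0)

/-- The integrand `(2 ‖J Γ‖² - tr(J) (Γ · J Γ)) / (Γ · J Γ)²`. -/
def phaseDensity (J : Mat) (Γ : Vec) : ℝ :=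
  (2 * ((J *ᵥ Γ) ⬝ᵥ (J *ᵥ Γ)) - J.trace * (Γ ⬝ᵥ (J *ᵥ Γ))) / (Γ ⬝ᵥ (J *ᵥ Γ)) ^ 2

/-- The closed parameter square. -/
def closedSquare : Set (ℝ × ℝ) := Icc 0 1 ×ˢ Icc 0 1

/-- The open parameter square. -/
def openSquare : Set (ℝ × ℝ) := Ioo 0 1 ×ˢ Ioo 0 1

/-- `σ` is a `C²` parametrized disc in the unit sphere, written in polar coordinates
`(s, t) = (radius, angle / 2π)`, whose oriented boundary is the closed curve `Γ : [0, T] → S²`: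
the edge `s = 0` is the centre of the disc, the edges `t = 0` and `t = 1` are glued, and the
edge `s = 1` is the boundary circle, on which `σ` runs once through `Γ`. The disc is allowed to
overlap itself, so `Γ` may have self-intersections. -/
structure IsSpanningSurface (T : ℝ) (Γ : ℝ → Vec) (σ : ℝ × ℝ → Vec) : Prop where
  contDiffOn : ContDiffOn ℝ 2 σ closedSquare
  mem_sphere : ∀ p ∈ closedSquare, σ p ⬝ᵥ σ p = 1
  centre : ∃ c : Vec, ∀ t ∈ Icc (0 : ℝ) 1, σ (0, t) = c
  glued : ∀ s ∈ Icc (0 : ℝ) 1, σ (s, 0) = σ (s, 1)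
  boundary : ∀ t ∈ Icc (0 : ℝ) 1, σ (1, t) = Γ (T * t)

/-- The oriented area element `σ · (∂ₛσ × ∂ₜσ)` of a parametrized surface in the unit sphere, for the
orientation of the sphere by its outward normal. -/
def areaElement (σ : ℝ × ℝ → Vec) (p : ℝ × ℝ) : ℝ :=
  σ p ⬝ᵥ (deriv (fun s => σ (s, p.2)) p.1 ⨯₃ deriv (fun t => σ (p.1, t)) p.2)

/-- The integral `∫_σ f dA` of `f` over the oriented parametrized surface `σ`. -/
def orientedSurfaceIntegral (f : Vec → ℝ) (σ : ℝ × ℝ → Vec) : ℝ :=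
  ∫ p in openSquare, f (σ p) * areaElement σ p

/-- `σ` does not overlap itself and is positively oriented for the outward normal of the sphere;
its boundary curve then runs counterclockwise around it, as seen from outside the sphere. -/
structure IsPositivelyEmbedded (σ : ℝ × ℝ → Vec) : Prop where
  injOn : InjOn σ openSquare
  areaElement_nonneg : ∀ p ∈ openSquare, 0 ≤ areaElement σ p

/-- The unit sphere `S²` in Euclidean space. -/
abbrev Sphere : Type := Metric.sphere (0 : EuclideanSpace ℝ (Fin 3)) 1

/-- The surface area measure `dA` of `S²`. -/
def sphereArea : Measure Sphere := (volume : Measure (EuclideanSpace ℝ (Fin 3))).toSphere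

/-- The subset of `S²` covered by the parametrized surface `σ`. -/
def surfaceImage (σ : ℝ × ℝ → Vec) : Set Sphere :=
  {x | WithLp.ofLp (x : EuclideanSpace ℝ (Fin 3)) ∈ σ '' closedSquare}

/-- The integral `∫_B f dA` of `f` over a subset `B` of `S²`, for the surface area measure. -/
def sphereIntegral (f : Vec → ℝ) (B : Set Sphere) : ℝ :=
  ∫ x in B, f (WithLp.ofLp (x : EuclideanSpace ℝ (Fin 3))) ∂sphereArea

end Pendulum3D

end

/-!
Over a disc the rotation picked up by the attitude is read off from a moving frame. The map
`R ↦ Rᵀ e₃` makes `SO(3)` a circle bundle over the sphere, and the motions with vanishing vertical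
momentum are the horizontal curves of the connection whose form, in a frame `(u, x × u, x)` of the
sphere, is `u · (x × du) + (J x · (dx × x)) / (x · J x)` (`connectionForm`). The first term is the
Levi-Civita part, whose exterior derivative is the area form; the second one is a one-form on the
sphere itself. Together their exterior derivative is `-phaseDensity J` times the area form
(`connectionForm_curvature`).

A spanning surface `σ` carries a `C²` unit tangent field `u` that is single-valued on the disc
(`IsSpanningSurface.exists_frameField`): the disc is contracted to its centre in short steps, and
a field along one of the discs is projected to the tangent planes of the next one. Let `α` be the
integral of the connection form along the boundary of `σ`. Green's theorem on the parameter square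
gives `-α = ∫_σ phaseDensity J dA` (`orientedSurfaceIntegral_phaseDensity`). On the other hand,
turning the frame along the boundary by minus the integral of the connection form makes it
horizontal; it then has the same angular velocity as the motion, so that the inner products of its
vectors with the rows of the attitude are constant. This gives `R T = rotz (-α) * R 0`
(`attitude_eq_rotz_mul`), where `rotz x = exp (x ê₃)`. The angle is unique modulo `2π` since
`rotz x` determines `cos x` and `sin x`.

For a positively embedded disc, the integral over its image for the area measure of the sphere is
three times the integral of the radially constant extension over the cone of height one in `ℝ³`, and
`(r, s, t) ↦ r σ(s, t)` has Jacobian determinant `r² σ · (∂ₛσ × ∂ₜσ)`; the change of variables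
formula of `ℝ³` identifies both notions of surface integral (`sphereIntegral_surfaceImage`).
-/

namespace Pendulum3D

/-! ### Calculus of dot and cross products, and the curvature of the connection -/

theorem hasDerivWithinAt_dotProduct {f g : ℝ → Vec} {f' g' : Vec} {S : Set ℝ} {t : ℝ}
    (hf : HasDerivWithinAt f f' S t) (hg : HasDerivWithinAt g g' S t) :
    HasDerivWithinAt (fun τ => f τ ⬝ᵥ g τ) (f' ⬝ᵥ g t + f t ⬝ᵥ g') S t := by
  have hf' := hasDerivWithinAt_pi.1 hf
  have hg' := hasDerivWithinAt_pi.1 hg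
  simp only [_root_.dotProduct]
  rw [← Finset.sum_add_distrib]
  exact HasDerivWithinAt.fun_sum fun i _ => (hf' i).mul (hg' i)

theorem hasDerivWithinAt_crossProduct {f g : ℝ → Vec} {f' g' : Vec} {S : Set ℝ} {t : ℝ}
    (hf : HasDerivWithinAt f f' S t) (hg : HasDerivWithinAt g g' S t) :
    HasDerivWithinAt (fun τ => f τ ⨯₃ g τ) (f' ⨯₃ g t + f t ⨯₃ g') S t := by
  have hf' := hasDerivWithinAt_pi.1 hf
  have hg' := hasDerivWithinAt_pi.1 hg
  refine hasDerivWithinAt_pi.2 fun i => ?_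
  fin_cases i
  · convert ((hf' 1).mul (hg' 2)).sub ((hf' 2).mul (hg' 1)) using 1
    · ext; simp [cross_apply]
    · simp [cross_apply]; ring
  · convert ((hf' 2).mul (hg' 0)).sub ((hf' 0).mul (hg' 2)) using 1
    · ext; simp [cross_apply]
    · simp [cross_apply]; ring
  · convert ((hf' 0).mul (hg' 1)).sub ((hf' 1).mul (hg' 0)) using 1
    · ext; simp [cross_apply]
    · simp [cross_apply]; ring

theorem hasDerivWithinAt_const_mulVec (J : Mat) {f : ℝ → Vec} {f' : Vec} {S : Set ℝ} {t : ℝ}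
    (hf : HasDerivWithinAt f f' S t) :
    HasDerivWithinAt (fun τ => J *ᵥ f τ) (J *ᵥ f') S t :=
  ((LinearMap.toContinuousLinearMap (Matrix.mulVecLin J)).hasFDerivAt).comp_hasDerivWithinAt t hf

theorem contDiffOn_dotProduct {E : Type*} [NormedAddCommGroup E] [NormedSpace ℝ E] {n : WithTop ℕ∞}
    {f g : E → Vec} {S : Set E} (hf : ContDiffOn ℝ n f S) (hg : ContDiffOn ℝ n g S) :
    ContDiffOn ℝ n (fun p => f p ⬝ᵥ g p) S := by
  have hf' := contDiffOn_pi.1 hf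
  have hg' := contDiffOn_pi.1 hg
  exact ContDiffOn.sum fun i _ => (hf' i).mul (hg' i)

theorem contDiffOn_crossProduct {E : Type*} [NormedAddCommGroup E] [NormedSpace ℝ E]
    {n : WithTop ℕ∞}
    {f g : E → Vec} {S : Set E} (hf : ContDiffOn ℝ n f S) (hg : ContDiffOn ℝ n g S) :
    ContDiffOn ℝ n (fun p => f p ⨯₃ g p) S := by
  have hf' := contDiffOn_pi.1 hf
  have hg' := contDiffOn_pi.1 hg
  refine contDiffOn_pi.2 fun i => ?_
  fin_cases i
  · exact (((hf' 1).mul (hg' 2)).sub ((hf' 2).mul (hg' 1))).congr fun p _ => by simp [cross_apply]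
  · exact (((hf' 2).mul (hg' 0)).sub ((hf' 0).mul (hg' 2))).congr fun p _ => by simp [cross_apply]
  · exact (((hf' 0).mul (hg' 1)).sub ((hf' 1).mul (hg' 0))).congr fun p _ => by simp [cross_apply]

theorem contDiffOn_const_mulVec {E : Type*} [NormedAddCommGroup E] [NormedSpace ℝ E]
    {n : WithTop ℕ∞} (J : Mat) {f : E → Vec} {S : Set E} (hf : ContDiffOn ℝ n f S) :
    ContDiffOn ℝ n (fun p => J *ᵥ f p) S :=
  (LinearMap.toContinuousLinearMap (Matrix.mulVecLin J)).contDiff.comp_contDiffOn hf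

/-- An orthonormal pair `u, x` is completed by `x ⨯₃ u` to an orthonormal basis. -/
theorem eq_sum_orthonormal {u x : Vec} (hu : u ⬝ᵥ u = 1) (hx : x ⬝ᵥ x = 1) (hux : u ⬝ᵥ x = 0)
    (w : Vec) :
    w = (w ⬝ᵥ u) • u + (w ⬝ᵥ (x ⨯₃ u)) • (x ⨯₃ u) + (w ⬝ᵥ x) • x := by
  have hvv : (x ⨯₃ u) ⬝ᵥ (x ⨯₃ u) = 1 := by
    rw [cross_dot_cross, hx, hu, hux]; simp
  have h1 : u ⬝ᵥ (x ⨯₃ u) = 0 := dot_cross_self x u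
  have h2 : x ⬝ᵥ (x ⨯₃ u) = 0 := dot_self_cross x u
  set v := x ⨯₃ u
  let M : Mat := Matrix.of ![u, v, x]
  have hM : M * Mᵀ = 1 := by
    ext i j
    change ![u, v, x] i ⬝ᵥ ![u, v, x] j = _
    fin_cases i <;> fin_cases j <;>
      simp [hu, hx, hux, hvv, h1, h2, dotProduct_comm v, dotProduct_comm x u]
  have hM' : Mᵀ * M = 1 := mul_eq_one_comm.1 hM
  have : Mᵀ *ᵥ (M *ᵥ w) = w := by rw [mulVec_mulVec, hM', one_mulVec]
  conv_lhs => rw [← this]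
  ext i
  simp [M, mulVec, dotProduct, Fin.sum_univ_three]
  ring

/-- The cross product of two tangent vectors at `x` is normal to the sphere. -/
theorem cross_tangent {x y z : Vec} (hx : x ⬝ᵥ x = 1) (hy : x ⬝ᵥ y = 0) (hz : x ⬝ᵥ z = 0) :
    y ⨯₃ z = (x ⬝ᵥ (y ⨯₃ z)) • x := by
  have h : x ⨯₃ (y ⨯₃ z) = 0 := by
    rw [cross_cross_eq_smul_sub_smul', hz, dotProduct_comm y x, hy]; simp
  have h2 : x ⨯₃ (x ⨯₃ (y ⨯₃ z)) = 0 := by rw [h]; simp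
  rw [cross_cross_eq_smul_sub_smul', hx, one_smul, sub_eq_zero] at h2
  exact h2.symm

/-- The derivative at the identity of `det` as the multiplier of the triple product. -/
theorem trace_triple (J : Mat) (x y z : Vec) :
    (J *ᵥ x) ⬝ᵥ (y ⨯₃ z) + x ⬝ᵥ ((J *ᵥ y) ⨯₃ z) + x ⬝ᵥ (y ⨯₃ (J *ᵥ z)) =
      J.trace * (x ⬝ᵥ (y ⨯₃ z)) := by
  simp [cross_apply, mulVec, dotProduct, Fin.sum_univ_three, trace]
  ring

/-- The connection one-form of the bundle `SO(3) → S²` whose horizontal curves have vanishing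
vertical momentum, pulled back to the sphere by an orthonormal frame `(u, x ⨯₃ u, x)`. It is
evaluated on a tangent vector `dx` at `x`, along which the frame vector `u` changes at the rate
`du`. -/
noncomputable def connectionForm (J : Mat) (x u dx du : Vec) : ℝ :=
  u ⬝ᵥ (x ⨯₃ du) + (J *ᵥ x) ⬝ᵥ (dx ⨯₃ x) / (x ⬝ᵥ (J *ᵥ x))

/-- The exterior derivative of the Levi-Civita part of the connection form is the area form. -/
theorem frame_curvature {x u xs xt us ut : Vec} (hx : x ⬝ᵥ x = 1) (hu : u ⬝ᵥ u = 1)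
    (hux : u ⬝ᵥ x = 0) (hxs : x ⬝ᵥ xs = 0) (hxt : x ⬝ᵥ xt = 0) (hus : u ⬝ᵥ us = 0)
    (hut : u ⬝ᵥ ut = 0) (huxs : us ⬝ᵥ x + u ⬝ᵥ xs = 0) (huxt : ut ⬝ᵥ x + u ⬝ᵥ xt = 0) :
    (us ⬝ᵥ (x ⨯₃ ut) + u ⬝ᵥ (xs ⨯₃ ut)) - (ut ⬝ᵥ (x ⨯₃ us) + u ⬝ᵥ (xt ⨯₃ us)) =
      x ⬝ᵥ (xs ⨯₃ xt) := by
  have hvv : (x ⨯₃ u) ⬝ᵥ (x ⨯₃ u) = 1 := by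
    rw [cross_dot_cross, hx, hu, hux]; simp
  have e1 := eq_sum_orthonormal hu hx hux xs
  have e2 := eq_sum_orthonormal hu hx hux xt
  have e3 := eq_sum_orthonormal hu hx hux us
  have e4 := eq_sum_orthonormal hu hx hux ut
  have h1 : u ⬝ᵥ (x ⨯₃ u) = 0 := dot_cross_self x u
  have h2 : x ⬝ᵥ (x ⨯₃ u) = 0 := dot_self_cross x u
  have hxu : x ⬝ᵥ u = 0 := by rw [dotProduct_comm, hux]
  have c1 : x ⨯₃ (x ⨯₃ u) = -u := by
    rw [cross_cross_eq_smul_sub_smul', hx, hxu]; simp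
  have c2 : u ⨯₃ (x ⨯₃ u) = x := by
    rw [cross_cross_eq_smul_sub_smul', hu, hxu]; simp
  have c3 : (x ⨯₃ u) ⨯₃ x = u := by rw [← cross_anticomm, c1, neg_neg]
  have c4 : (x ⨯₃ u) ⨯₃ u = -x := by rw [← cross_anticomm, c2]
  have c5 : u ⨯₃ x = -(x ⨯₃ u) := by rw [cross_anticomm]
  rw [dotProduct_comm xs x, hxs] at e1
  rw [dotProduct_comm xt x, hxt] at e2
  rw [dotProduct_comm us u, hus, eq_neg_of_add_eq_zero_left huxs, dotProduct_comm u xs] at e3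
  rw [dotProduct_comm ut u, hut, eq_neg_of_add_eq_zero_left huxt, dotProduct_comm u xt] at e4
  generalize xs ⬝ᵥ u = a1 at *
  generalize xs ⬝ᵥ (x ⨯₃ u) = a2 at *
  generalize xt ⬝ᵥ u = b1 at *
  generalize xt ⬝ᵥ (x ⨯₃ u) = b2 at *
  generalize us ⬝ᵥ (x ⨯₃ u) = m at *
  generalize ut ⬝ᵥ (x ⨯₃ u) = n at *
  generalize hv : x ⨯₃ u = v at *
  subst e1 e2 e3 e4
  have h1' : v ⬝ᵥ u = 0 := by rw [dotProduct_comm, h1]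
  simp [c1, c2, c3, c4, c5, h1, hux, hu, hx, h1', hxu]
  ring

theorem dotProduct_mulVec_pos {J : Mat} (hJ : J.PosDef) {x : Vec} (hx : x ⬝ᵥ x = 1) :
    0 < x ⬝ᵥ (J *ᵥ x) := by
  have hx0 : x ≠ 0 := by rintro rfl; simp at hx
  simpa using hJ.dotProduct_mulVec_pos hx0

theorem mulVec_dotProduct_comm {J : Mat} (hJ : J.PosDef) (x y : Vec) :
    x ⬝ᵥ (J *ᵥ y) = (J *ᵥ x) ⬝ᵥ y := by
  have h : Jᵀ = J := by simpa using hJ.isHermitian.eq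
  rw [dotProduct_mulVec, ← mulVec_transpose, h]

/-- The curvature of the connection form is `-phaseDensity J` times the area form. -/
theorem connectionForm_curvature {J : Mat} (hJ : J.PosDef) {x u xs xt us ut xst ust : Vec}
    (hx : x ⬝ᵥ x = 1) (hu : u ⬝ᵥ u = 1)
    (hux : u ⬝ᵥ x = 0) (hxs : x ⬝ᵥ xs = 0) (hxt : x ⬝ᵥ xt = 0) (hus : u ⬝ᵥ us = 0)
    (hut : u ⬝ᵥ ut = 0) (huxs : us ⬝ᵥ x + u ⬝ᵥ xs = 0) (huxt : ut ⬝ᵥ x + u ⬝ᵥ xt = 0) :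
    (us ⬝ᵥ (x ⨯₃ ut) + u ⬝ᵥ (xs ⨯₃ ut + x ⨯₃ ust) +
        (((J *ᵥ xs) ⬝ᵥ (xt ⨯₃ x) + (J *ᵥ x) ⬝ᵥ (xst ⨯₃ x + xt ⨯₃ xs)) * (x ⬝ᵥ (J *ᵥ x)) -
          (J *ᵥ x) ⬝ᵥ (xt ⨯₃ x) * (xs ⬝ᵥ (J *ᵥ x) + x ⬝ᵥ (J *ᵥ xs))) / (x ⬝ᵥ (J *ᵥ x)) ^ 2) -
      (ut ⬝ᵥ (x ⨯₃ us) + u ⬝ᵥ (xt ⨯₃ us + x ⨯₃ ust) +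
        (((J *ᵥ xt) ⬝ᵥ (xs ⨯₃ x) + (J *ᵥ x) ⬝ᵥ (xst ⨯₃ x + xs ⨯₃ xt)) * (x ⬝ᵥ (J *ᵥ x)) -
          (J *ᵥ x) ⬝ᵥ (xs ⨯₃ x) * (xt ⬝ᵥ (J *ᵥ x) + x ⬝ᵥ (J *ᵥ xt))) / (x ⬝ᵥ (J *ᵥ x)) ^ 2) =
      -(phaseDensity J x * (x ⬝ᵥ (xs ⨯₃ xt))) := by
  have hq := dotProduct_mulVec_pos hJ hx
  have hF := frame_curvature hx hu hux hxs hxt hus hut huxs huxt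
  have hTr := trace_triple J xs xt x
  have hcr := cross_tangent hx hxs hxt
  have hts : xt ⨯₃ xs = -(xs ⨯₃ xt) := by rw [cross_anticomm]
  have hperm : xs ⬝ᵥ (xt ⨯₃ x) = x ⬝ᵥ (xs ⨯₃ xt) := by
    rw [triple_product_permutation x]
  have hperm2 : xs ⬝ᵥ ((J *ᵥ xt) ⨯₃ x) = -((J *ᵥ xt) ⬝ᵥ (xs ⨯₃ x)) := by
    rw [triple_product_permutation, ← cross_anticomm, dotProduct_neg]
  have hperm3 : xs ⬝ᵥ (xt ⨯₃ (J *ᵥ x)) = (J *ᵥ x) ⬝ᵥ (xs ⨯₃ xt) := by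
    rw [triple_product_permutation (J *ᵥ x)]
  have hJD : (J *ᵥ x) ⬝ᵥ (xs ⨯₃ xt) = (x ⬝ᵥ (xs ⨯₃ xt)) * (x ⬝ᵥ (J *ᵥ x)) := by
    conv_lhs => rw [hcr]
    rw [dotProduct_smul, smul_eq_mul, dotProduct_comm x (J *ᵥ x)]
  -- The quadratic term is a double cross product of `J *ᵥ x` with `xs ⨯₃ xt`.
  have hquad : (J *ᵥ x) ⬝ᵥ (xt ⨯₃ x) * ((J *ᵥ x) ⬝ᵥ xs) -
      (J *ᵥ x) ⬝ᵥ (xs ⨯₃ x) * ((J *ᵥ x) ⬝ᵥ xt) =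
      (x ⬝ᵥ (xs ⨯₃ xt)) * ((J *ᵥ x) ⬝ᵥ (J *ᵥ x) - (x ⬝ᵥ (J *ᵥ x)) ^ 2) := by
    generalize J *ᵥ x = y at *
    have h1 : y ⨯₃ (xs ⨯₃ xt) = (y ⬝ᵥ xt) • xs - (y ⬝ᵥ xs) • xt := by
      rw [cross_cross_eq_smul_sub_smul', dotProduct_comm xs y]
    have h2 : y ⬝ᵥ ((y ⨯₃ (xs ⨯₃ xt)) ⨯₃ x) =
        (x ⬝ᵥ (xs ⨯₃ xt)) * ((x ⬝ᵥ y) ^ 2 - y ⬝ᵥ y) := by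
      conv_lhs => rw [hcr]
      rw [LinearMap.map_smul, LinearMap.map_smul, LinearMap.smul_apply, dotProduct_smul,
        cross_cross_eq_smul_sub_smul]
      simp [hx, dotProduct_comm y x]
      left; ring
    rw [h1] at h2
    simp at h2
    linear_combination -h2
  rw [← mulVec_dotProduct_comm hJ x xs, ← mulVec_dotProduct_comm hJ x xt] at hquad
  rw [mulVec_dotProduct_comm hJ xs x, dotProduct_comm (J *ᵥ xs) x,
    mulVec_dotProduct_comm hJ xt x, dotProduct_comm (J *ᵥ xt) x]
  rw [hperm, hperm2, hperm3, hJD] at hTr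
  simp only [dotProduct_add, hts, dotProduct_neg, hJD, phaseDensity]
  generalize x ⬝ᵥ (J *ᵥ x) = q at *
  field_simp
  linear_combination q ^ 2 * hF + q * hTr - 2 * hquad

theorem hasDerivWithinAt_connectionForm {J : Mat} {x u y w : ℝ → Vec} {x' u' y' w' : Vec}
    {S : Set ℝ} {t : ℝ}
    (hx : HasDerivWithinAt x x' S t) (hu : HasDerivWithinAt u u' S t)
    (hy : HasDerivWithinAt y y' S t) (hw : HasDerivWithinAt w w' S t)
    (hq : x t ⬝ᵥ (J *ᵥ x t) ≠ 0) :
    HasDerivWithinAt (fun τ => connectionForm J (x τ) (u τ) (y τ) (w τ))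
      (u' ⬝ᵥ (x t ⨯₃ w t) + u t ⬝ᵥ (x' ⨯₃ w t + x t ⨯₃ w') +
        (((J *ᵥ x') ⬝ᵥ (y t ⨯₃ x t) + (J *ᵥ x t) ⬝ᵥ (y' ⨯₃ x t + y t ⨯₃ x')) *
            (x t ⬝ᵥ (J *ᵥ x t)) -
          (J *ᵥ x t) ⬝ᵥ (y t ⨯₃ x t) * (x' ⬝ᵥ (J *ᵥ x t) + x t ⬝ᵥ (J *ᵥ x'))) /
            (x t ⬝ᵥ (J *ᵥ x t)) ^ 2) S t :=
  (hasDerivWithinAt_dotProduct hu (hasDerivWithinAt_crossProduct hx hw)).add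
    ((hasDerivWithinAt_dotProduct (hasDerivWithinAt_const_mulVec J hx)
      (hasDerivWithinAt_crossProduct hy hx)).div
      (hasDerivWithinAt_dotProduct hx (hasDerivWithinAt_const_mulVec J hx)) hq)

/-! ### Frame fields along a disc -/

/-- The orthogonal projection of `u` to the tangent plane of the sphere at `x`, normalized. -/
noncomputable def transport (x u : Vec) : Vec :=
  (Real.sqrt (1 - (u ⬝ᵥ x) ^ 2))⁻¹ • (u - (u ⬝ᵥ x) • x)

/-- `u` is not normal to the sphere at `x` if it is tangent at a point `y` that is not orthogonal to
`x`; hence its projection to the tangent plane at `x` does not vanish. -/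
theorem dotProduct_sq_lt_one {x y u : Vec} (hx : x ⬝ᵥ x = 1) (hu : u ⬝ᵥ u = 1)
    (huy : u ⬝ᵥ y = 0) (hxy : x ⬝ᵥ y ≠ 0) : 0 < 1 - (u ⬝ᵥ x) ^ 2 := by
  have h : (u - (u ⬝ᵥ x) • x) ⬝ᵥ (u - (u ⬝ᵥ x) • x) = 1 - (u ⬝ᵥ x) ^ 2 := by
    simp [hx, hu, dotProduct_comm x u]; ring
  refine lt_of_le_of_ne ?_ fun h0 => ?_
  · rw [← h]
    exact Finset.sum_nonneg fun i _ => mul_self_nonneg _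
  · rw [← h0, dotProduct_self_eq_zero, sub_eq_zero] at h
    have h1 : u ⬝ᵥ y = (u ⬝ᵥ x) * (x ⬝ᵥ y) := by
      conv_lhs => rw [h]
      simp
    rw [huy, zero_eq_mul] at h1
    rcases h1 with h1 | h1
    · rw [h1] at h0; norm_num at h0
    · exact hxy h1

theorem transport_dotProduct_self {x u : Vec} (hx : x ⬝ᵥ x = 1) (hu : u ⬝ᵥ u = 1)
    (h : 0 < 1 - (u ⬝ᵥ x) ^ 2) : transport x u ⬝ᵥ transport x u = 1 := by
  have h1 : (u - (u ⬝ᵥ x) • x) ⬝ᵥ (u - (u ⬝ᵥ x) • x) = 1 - (u ⬝ᵥ x) ^ 2 := by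
    simp [hx, hu, dotProduct_comm x u]; ring
  rw [transport, smul_dotProduct, dotProduct_smul, h1, smul_eq_mul, smul_eq_mul]
  have h2 := Real.sq_sqrt h.le
  have h3 : Real.sqrt (1 - (u ⬝ᵥ x) ^ 2) ≠ 0 := (Real.sqrt_pos.2 h).ne'
  field_simp
  exact h2.symm

theorem transport_dotProduct {x : Vec} (hx : x ⬝ᵥ x = 1) (u : Vec) : transport x u ⬝ᵥ x = 0 := by
  simp [transport, hx]

theorem contDiffOn_transport {E : Type*} [NormedAddCommGroup E] [NormedSpace ℝ E]
    {n : WithTop ℕ∞} {x u : E → Vec} {S : Set E} (hx : ContDiffOn ℝ n x S)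
    (hu : ContDiffOn ℝ n u S) (h : ∀ p ∈ S, 0 < 1 - (u p ⬝ᵥ x p) ^ 2) :
    ContDiffOn ℝ n (fun p => transport (x p) (u p)) S := by
  have hd := contDiffOn_dotProduct hu hx
  exact (((contDiffOn_const.sub (hd.pow 2)).sqrt fun p hp => (h p hp).ne').inv
    fun p hp => (Real.sqrt_pos.2 (h p hp)).ne').smul (hu.sub (hd.smul hx))

theorem exists_unit_orthogonal (c : Vec) : ∃ u : Vec, u ⬝ᵥ u = 1 ∧ u ⬝ᵥ c = 0 := by
  by_cases h : c 0 ^ 2 + c 1 ^ 2 = 0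
  · have h0 : c 0 = 0 := by nlinarith [sq_nonneg (c 0), sq_nonneg (c 1)]
    exact ⟨![1, 0, 0], by simp [dotProduct, Fin.sum_univ_three],
      by simp [dotProduct, Fin.sum_univ_three, h0]⟩
  · have hpos : 0 < c 0 ^ 2 + c 1 ^ 2 := lt_of_le_of_ne (by positivity) (Ne.symm h)
    have h1 := Real.sq_sqrt hpos.le
    have h2 : Real.sqrt (c 0 ^ 2 + c 1 ^ 2) ≠ 0 := (Real.sqrt_pos.2 hpos).ne'
    refine ⟨(Real.sqrt (c 0 ^ 2 + c 1 ^ 2))⁻¹ • ![-c 1, c 0, 0], ?_, ?_⟩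
    · simp [dotProduct, Fin.sum_univ_three]
      field_simp
      linarith
    · simp [dotProduct, Fin.sum_univ_three]
      ring

theorem dotProduct_pos_of_dist_lt {x y : Vec} (hx : x ⬝ᵥ x = 1) (hy : y ⬝ᵥ y = 1)
    (h : dist x y < 1 / 2) : 0 < x ⬝ᵥ y := by
  have hi : ∀ i, (x i - y i) ^ 2 < 1 / 4 := fun i => by
    have h1 := (dist_le_pi_dist x y i).trans_lt h
    rw [Real.dist_eq, abs_lt] at h1
    nlinarith
  have h0 := hi 0
  have h1 := hi 1
  have h2 := hi 2
  simp only [dotProduct, Fin.sum_univ_three] at *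
  nlinarith

/-- A unit tangent field along a disc in the sphere which descends to the disc, that is, it is
single-valued at the centre and on the glued edges. Together with `σ ⨯₃ u` and `σ` it is a lift of
the disc to the frame bundle `SO(3)` of the sphere. -/
structure IsFrameField (σ u : ℝ × ℝ → Vec) : Prop where
  contDiffOn : ContDiffOn ℝ 2 u closedSquare
  unit : ∀ p ∈ closedSquare, u p ⬝ᵥ u p = 1
  tangent : ∀ p ∈ closedSquare, u p ⬝ᵥ σ p = 0
  centre : ∃ c : Vec, ∀ t ∈ Icc (0 : ℝ) 1, u (0, t) = c
  glued : ∀ s ∈ Icc (0 : ℝ) 1, u (s, 0) = u (s, 1)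

/-- The disc can be shrunk to its centre in steps short enough for the frame field to be carried
over from each disc to the next one by projection. -/
theorem IsSpanningSurface.exists_frameField {T : ℝ} {Γ : ℝ → Vec} {σ : ℝ × ℝ → Vec}
    (h : IsSpanningSurface T Γ σ) : ∃ u, IsFrameField σ u := by
  have hcpt : IsCompact closedSquare := isCompact_Icc.prod isCompact_Icc
  obtain ⟨c, hc⟩ := h.centre
  obtain ⟨δ, hδ, hunif⟩ := Metric.uniformContinuousOn_iff.1
    (hcpt.uniformContinuousOn_of_continuous h.contDiffOn.continuousOn) (1 / 2) (by norm_num)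
  obtain ⟨N, hN⟩ := exists_nat_one_div_lt hδ
  have hN0 : (0 : ℝ) < N + 1 := by positivity
  have hmaps : ∀ r ∈ Icc (0 : ℝ) 1, ∀ p ∈ closedSquare, (r * p.1, p.2) ∈ closedSquare := by
    rintro r hr p ⟨hp1, hp2⟩
    exact ⟨⟨mul_nonneg hr.1 hp1.1, mul_le_one₀ hr.2 hp1.1 hp1.2⟩, hp2⟩
  -- The disc shrunk by the factor `k / (N + 1)` has a frame field, by induction on `k`.
  have key : ∀ k : ℕ, k ≤ N + 1 →
      ∃ u, IsFrameField (fun p => σ ((k / (N + 1) : ℝ) * p.1, p.2)) u := by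
    intro k
    induction k with
    | zero =>
      intro _
      obtain ⟨u, hu, huc⟩ := exists_unit_orthogonal c
      refine ⟨fun _ => u, contDiffOn_const, fun _ _ => hu, fun p hp => ?_, ⟨u, fun _ _ => rfl⟩,
        fun _ _ => rfl⟩
      simp only [Nat.cast_zero, zero_div, zero_mul]
      rw [hc _ hp.2, huc]
    | succ k ih =>
      intro hk
      obtain ⟨u, hu⟩ := ih (by omega)
      have hkN : ((k + 1 : ℕ) : ℝ) ≤ N + 1 := by exact_mod_cast hk
      have hr : (k / (N + 1) : ℝ) ∈ Icc (0 : ℝ) 1 :=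
        ⟨by positivity, (div_le_one hN0).2 (by push_cast at hkN; linarith)⟩
      have hr' : (((k + 1 : ℕ) : ℝ) / (N + 1) : ℝ) ∈ Icc (0 : ℝ) 1 :=
        ⟨by positivity, (div_le_one hN0).2 hkN⟩
      have hunit : ∀ p ∈ closedSquare, _ := fun p hp => h.mem_sphere _ (hmaps _ hr' p hp)
      have hpos : ∀ p ∈ closedSquare,
          0 < 1 - (u p ⬝ᵥ σ ((((k + 1 : ℕ) : ℝ) / (N + 1) : ℝ) * p.1, p.2)) ^ 2 := by
        intro p hp
        refine dotProduct_sq_lt_one (hunit p hp) (hu.unit p hp) (hu.tangent p hp)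
          (dotProduct_pos_of_dist_lt (hunit p hp) (h.mem_sphere _ (hmaps _ hr p hp)) ?_).ne'
        refine hunif _ (hmaps _ hr' p hp) _ (hmaps _ hr p hp) (lt_of_le_of_lt ?_ hN)
        have hp1 := hp.1.1
        have hp2 := hp.1.2
        rw [Prod.dist_eq, dist_self, max_eq_left dist_nonneg, Real.dist_eq, ← sub_mul, ← sub_div]
        push_cast
        rw [add_sub_cancel_left, abs_of_nonneg (by positivity)]
        exact mul_le_of_le_one_right (by positivity) hp2
      have hsmooth : ContDiffOn ℝ 2
          (fun p : ℝ × ℝ => σ ((((k + 1 : ℕ) : ℝ) / (N + 1) : ℝ) * p.1, p.2)) closedSquare :=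
        h.contDiffOn.comp
          (contDiffOn_const.mul contDiffOn_fst |>.prodMk contDiffOn_snd) (hmaps _ hr')
      refine ⟨fun p => transport (σ ((((k + 1 : ℕ) : ℝ) / (N + 1) : ℝ) * p.1, p.2)) (u p),
        contDiffOn_transport hsmooth hu.contDiffOn hpos,
        fun p hp => transport_dotProduct_self (hunit p hp) (hu.unit p hp) (hpos p hp),
        fun p hp => transport_dotProduct (hunit p hp) _, ?_, ?_⟩
      · obtain ⟨d, hd⟩ := hu.centre
        refine ⟨transport c d, fun t ht => ?_⟩
        simp only [mul_zero]
        rw [hc t ht, hd t ht]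
      · intro s hs
        have hs' := (hmaps _ hr' (s, 0) ⟨hs, by simp⟩).1
        simp only at hs' ⊢
        rw [h.glued _ hs', hu.glued s hs]
  obtain ⟨u, hu⟩ := key (N + 1) le_rfl
  refine ⟨u, ?_⟩
  have : ((N + 1 : ℕ) : ℝ) / (N + 1) = 1 := by push_cast; exact div_self hN0.ne'
  simpa only [this, one_mul, Prod.mk.eta] using hu

/-! ### Green's theorem for the connection form on the parameter square -/

theorem uniqueDiffOn_closedSquare : UniqueDiffOn ℝ closedSquare :=
  (uniqueDiffOn_Icc_zero_one).prod (uniqueDiffOn_Icc_zero_one)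

theorem isCompact_closedSquare : IsCompact closedSquare := isCompact_Icc.prod isCompact_Icc

theorem closedSquare_mem_nhds {p : ℝ × ℝ} (hp : p ∈ openSquare) : closedSquare ∈ nhds p :=
  prod_mem_nhds (Icc_mem_nhds hp.1.1 hp.1.2) (Icc_mem_nhds hp.2.1 hp.2.2)

theorem isOpen_openSquare : IsOpen openSquare := isOpen_Ioo.prod isOpen_Ioo

theorem openSquare_subset : openSquare ⊆ closedSquare :=
  prod_mono Ioo_subset_Icc_self Ioo_subset_Icc_self

section Partial

variable {F : Type*} [NormedAddCommGroup F] [NormedSpace ℝ F]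

/-- The partial derivative in the radial parameter `s`, one-sided on the boundary of the square. -/
noncomputable def partialS (f : ℝ × ℝ → F) (p : ℝ × ℝ) : F :=
  fderivWithin ℝ f closedSquare p (1, 0)

/-- The partial derivative in the angular parameter `t`, one-sided on the boundary of the square. -/
noncomputable def partialT (f : ℝ × ℝ → F) (p : ℝ × ℝ) : F :=
  fderivWithin ℝ f closedSquare p (0, 1)

theorem hasDerivWithinAt_partialS {f : ℝ × ℝ → F} (hf : DifferentiableOn ℝ f closedSquare)
    {s t : ℝ} (hs : s ∈ Icc (0 : ℝ) 1) (ht : t ∈ Icc (0 : ℝ) 1) :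
    HasDerivWithinAt (fun τ => f (τ, t)) (partialS f (s, t)) (Icc 0 1) s :=
  (hf (s, t) ⟨hs, ht⟩).hasFDerivWithinAt.comp_hasDerivWithinAt (f := fun τ => (τ, t)) s
    ((hasDerivWithinAt_id s _).prodMk (hasDerivWithinAt_const s _ t)) fun _ hτ => ⟨hτ, ht⟩

theorem hasDerivWithinAt_partialT {f : ℝ × ℝ → F} (hf : DifferentiableOn ℝ f closedSquare)
    {s t : ℝ} (hs : s ∈ Icc (0 : ℝ) 1) (ht : t ∈ Icc (0 : ℝ) 1) :
    HasDerivWithinAt (fun τ => f (s, τ)) (partialT f (s, t)) (Icc 0 1) t :=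
  (hf (s, t) ⟨hs, ht⟩).hasFDerivWithinAt.comp_hasDerivWithinAt (f := fun τ => (s, τ)) t
    ((hasDerivWithinAt_const t _ s).prodMk (hasDerivWithinAt_id t _)) fun _ hτ => ⟨hs, hτ⟩

theorem contDiffOn_partialS {f : ℝ × ℝ → F} {m n : WithTop ℕ∞} (hf : ContDiffOn ℝ n f closedSquare)
    (hmn : m + 1 ≤ n) : ContDiffOn ℝ m (partialS f) closedSquare :=
  (hf.fderivWithin uniqueDiffOn_closedSquare hmn).clm_apply contDiffOn_const

theorem contDiffOn_partialT {f : ℝ × ℝ → F} {m n : WithTop ℕ∞} (hf : ContDiffOn ℝ n f closedSquare)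
    (hmn : m + 1 ≤ n) : ContDiffOn ℝ m (partialT f) closedSquare :=
  (hf.fderivWithin uniqueDiffOn_closedSquare hmn).clm_apply contDiffOn_const

theorem partialS_partialT_comm {f : ℝ × ℝ → F} (hf : ContDiffOn ℝ 2 f closedSquare)
    {p : ℝ × ℝ} (hp : p ∈ openSquare) :
    partialS (partialT f) p = partialT (partialS f) p := by
  have hnhds := closedSquare_mem_nhds hp
  have hmem := openSquare_subset hp
  have hd : DifferentiableWithinAt ℝ (fderivWithin ℝ f closedSquare) closedSquare p :=
    (hf.fderivWithin uniqueDiffOn_closedSquare (m := 1) (by norm_num)).differentiableOn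
      one_ne_zero p hmem
  have happ : ∀ v w : ℝ × ℝ,
      fderivWithin ℝ (fun q => fderivWithin ℝ f closedSquare q v) closedSquare p w =
        fderivWithin ℝ (fderivWithin ℝ f closedSquare) closedSquare p w v := by
    intro v w
    rw [fderivWithin_clm_apply (uniqueDiffOn_closedSquare p hmem) hd
      (differentiableWithinAt_const v)]
    simp
  have hsymm : IsSymmSndFDerivWithinAt ℝ f closedSquare p := by
    refine ContDiffWithinAt.isSymmSndFDerivWithinAt (hf p hmem) (by simp)
      uniqueDiffOn_closedSquare ?_ hmem
    exact subset_closure (mem_interior_iff_mem_nhds.2 hnhds)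
  simp only [partialS, partialT]
  exact (happ _ _).trans ((hsymm _ _).trans (happ _ _).symm)

end Partial

theorem integral_openSquare_eq (f : ℝ × ℝ → ℝ) :
    ∫ p in openSquare, f p = ∫ p in closedSquare, f p := by
  refine setIntegral_congr_set ?_
  exact Measure.set_prod_ae_eq Ioo_ae_eq_Icc Ioo_ae_eq_Icc

/-- Green's theorem on the unit square. -/
theorem green_unitSquare {f g : ℝ × ℝ → ℝ} (hf : ContDiffOn ℝ 1 f closedSquare)
    (hg : ContDiffOn ℝ 1 g closedSquare) :
    ∫ p in openSquare, (partialS g p - partialT f p) =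
      (∫ t in (0 : ℝ)..1, g (1, t)) - (∫ t in (0 : ℝ)..1, g (0, t)) -
        ((∫ s in (0 : ℝ)..1, f (s, 1)) - ∫ s in (0 : ℝ)..1, f (s, 0)) := by
  have hIcc : Icc ((0 : ℝ), (0 : ℝ)) (1, 1) = closedSquare := by
    rw [closedSquare, Icc_prod_Icc]
  have hd : ∀ h : ℝ × ℝ → ℝ, ContDiffOn ℝ 1 h closedSquare → ∀ p ∈ openSquare,
      HasFDerivAt h (fderivWithin ℝ h closedSquare p) p := fun h hh p hp =>
    (hh.differentiableOn one_ne_zero p (openSquare_subset hp)).hasFDerivWithinAt.hasFDerivAt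
      (closedSquare_mem_nhds hp)
  have hint : IntegrableOn (fun p => partialS g p - partialT f p) closedSquare :=
    ((contDiffOn_partialS hg (m := 0) (by simp)).continuousOn.sub
      (contDiffOn_partialT hf (m := 0) (by simp)).continuousOn).integrableOn_compact
        isCompact_closedSquare
  have key := integral_divergence_prod_Icc_of_hasFDerivAt_of_le g (fun p => -f p)
    (fun p => fderivWithin ℝ g closedSquare p) (fun p => -fderivWithin ℝ f closedSquare p)
    (0, 0) (1, 1) ⟨zero_le_one, zero_le_one⟩
    (by rw [hIcc]; exact hg.continuousOn) (by rw [hIcc]; exact hf.continuousOn.neg)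
    (hd g hg) (fun p hp => (hd f hf p hp).neg)
    (by rw [hIcc]; simpa [sub_eq_add_neg, partialS, partialT] using hint)
  rw [hIcc] at key
  rw [integral_openSquare_eq]
  simp only [_root_.neg_apply, ← sub_eq_add_neg, intervalIntegral.integral_neg] at key
  simp only [partialS, partialT]
  rw [key]
  ring

section Disc

variable {J : Mat} {T : ℝ} {Γ : ℝ → Vec} {σ u : ℝ × ℝ → Vec}

theorem dotProduct_deriv_eq_zero {x y : ℝ → Vec} {x' y' : Vec} {c t : ℝ} {S : Set ℝ}
    (hx : HasDerivWithinAt x x' S t) (hy : HasDerivWithinAt y y' S t)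
    (hS : UniqueDiffWithinAt ℝ S t) (ht : t ∈ S) (h : ∀ τ ∈ S, x τ ⬝ᵥ y τ = c) :
    x' ⬝ᵥ y t + x t ⬝ᵥ y' = 0 :=
  hS.eq_deriv _ (hasDerivWithinAt_dotProduct hx hy)
    ((hasDerivWithinAt_const t S c).congr h (h t ht))

theorem dotProduct_deriv_self_eq_zero {x : ℝ → Vec} {x' : Vec} {c t : ℝ} {S : Set ℝ}
    (hx : HasDerivWithinAt x x' S t)
    (hS : UniqueDiffWithinAt ℝ S t) (ht : t ∈ S) (h : ∀ τ ∈ S, x τ ⬝ᵥ x τ = c) :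
    x t ⬝ᵥ x' = 0 := by
  have := dotProduct_deriv_eq_zero hx hx hS ht h
  rw [dotProduct_comm x' (x t)] at this
  linarith

/-- The coefficient of `ds` in the connection form pulled back to the parameter square. -/
noncomputable def connS (J : Mat) (σ u : ℝ × ℝ → Vec) (p : ℝ × ℝ) : ℝ :=
  connectionForm J (σ p) (u p) (partialS σ p) (partialS u p)

/-- The coefficient of `dt` in the connection form pulled back to the parameter square. -/
noncomputable def connT (J : Mat) (σ u : ℝ × ℝ → Vec) (p : ℝ × ℝ) : ℝ :=
  connectionForm J (σ p) (u p) (partialT σ p) (partialT u p)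

theorem contDiffOn_connectionForm {n : WithTop ℕ∞} {S : Set (ℝ × ℝ)} {x v y w : ℝ × ℝ → Vec}
    (hx : ContDiffOn ℝ n x S) (hv : ContDiffOn ℝ n v S) (hy : ContDiffOn ℝ n y S)
    (hw : ContDiffOn ℝ n w S) (hq : ∀ p ∈ S, x p ⬝ᵥ (J *ᵥ x p) ≠ 0) :
    ContDiffOn ℝ n (fun p => connectionForm J (x p) (v p) (y p) (w p)) S :=
  (contDiffOn_dotProduct hv (contDiffOn_crossProduct hx hw)).add
    ((contDiffOn_dotProduct (contDiffOn_const_mulVec J hx) (contDiffOn_crossProduct hy hx)).div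
      (contDiffOn_dotProduct hx (contDiffOn_const_mulVec J hx)) hq)

theorem contDiffOn_connS (hJ : J.PosDef) (hσ : IsSpanningSurface T Γ σ) (hu : IsFrameField σ u) :
    ContDiffOn ℝ 1 (connS J σ u) closedSquare :=
  contDiffOn_connectionForm (hσ.contDiffOn.of_le (by norm_num)) (hu.contDiffOn.of_le (by norm_num))
    (contDiffOn_partialS hσ.contDiffOn (by norm_num))
    (contDiffOn_partialS hu.contDiffOn (by norm_num))
    fun p hp => (dotProduct_mulVec_pos hJ (hσ.mem_sphere p hp)).ne'

theorem contDiffOn_connT (hJ : J.PosDef) (hσ : IsSpanningSurface T Γ σ) (hu : IsFrameField σ u) :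
    ContDiffOn ℝ 1 (connT J σ u) closedSquare :=
  contDiffOn_connectionForm (hσ.contDiffOn.of_le (by norm_num)) (hu.contDiffOn.of_le (by norm_num))
    (contDiffOn_partialT hσ.contDiffOn (by norm_num))
    (contDiffOn_partialT hu.contDiffOn (by norm_num))
    fun p hp => (dotProduct_mulVec_pos hJ (hσ.mem_sphere p hp)).ne'

theorem areaElement_eq (hσ : DifferentiableOn ℝ σ closedSquare) {p : ℝ × ℝ} (hp : p ∈ openSquare) :
    areaElement σ p = σ p ⬝ᵥ (partialS σ p ⨯₃ partialT σ p) := by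
  have h := openSquare_subset hp
  have h1 := (hasDerivWithinAt_partialS hσ h.1 h.2).hasDerivAt (Icc_mem_nhds hp.1.1 hp.1.2)
  have h2 := (hasDerivWithinAt_partialT hσ h.1 h.2).hasDerivAt (Icc_mem_nhds hp.2.1 hp.2.2)
  rw [areaElement, h1.deriv, h2.deriv]

/-- The exterior derivative of the connection form on the parameter square. -/
theorem curl_conn (hJ : J.PosDef) (hσ : IsSpanningSurface T Γ σ) (hu : IsFrameField σ u)
    {p : ℝ × ℝ} (hp : p ∈ openSquare) :
    partialS (connT J σ u) p - partialT (connS J σ u) p =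
      -(phaseDensity J (σ p) * areaElement σ p) := by
  obtain ⟨s, t⟩ := p
  obtain ⟨hs, ht⟩ := openSquare_subset hp
  simp only at hs ht
  have hσ1 := hσ.contDiffOn.differentiableOn two_ne_zero
  have hu1 := hu.contDiffOn.differentiableOn two_ne_zero
  have hsσ := contDiffOn_partialS (m := 1) hσ.contDiffOn (by norm_num)
  have htσ := contDiffOn_partialT (m := 1) hσ.contDiffOn (by norm_num)
  have hsu := contDiffOn_partialS (m := 1) hu.contDiffOn (by norm_num)
  have htu := contDiffOn_partialT (m := 1) hu.contDiffOn (by norm_num)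
  have hq := (dotProduct_mulVec_pos hJ (hσ.mem_sphere (s, t) ⟨hs, ht⟩)).ne'
  have hUs := uniqueDiffOn_Icc_zero_one s hs
  have hUt := uniqueDiffOn_Icc_zero_one t ht
  have dσs := hasDerivWithinAt_partialS hσ1 hs ht
  have dσt := hasDerivWithinAt_partialT hσ1 hs ht
  have dus := hasDerivWithinAt_partialS hu1 hs ht
  have dut := hasDerivWithinAt_partialT hu1 hs ht
  have e1 := hUs.eq_deriv _ (hasDerivWithinAt_partialS
    ((contDiffOn_connT hJ hσ hu).differentiableOn one_ne_zero) hs ht)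
    (hasDerivWithinAt_connectionForm dσs dus
      (hasDerivWithinAt_partialS (htσ.differentiableOn one_ne_zero) hs ht)
      (hasDerivWithinAt_partialS (htu.differentiableOn one_ne_zero) hs ht) hq)
  have e2 := hUt.eq_deriv _ (hasDerivWithinAt_partialT
    ((contDiffOn_connS hJ hσ hu).differentiableOn one_ne_zero) hs ht)
    (hasDerivWithinAt_connectionForm dσt dut
      (hasDerivWithinAt_partialT (hsσ.differentiableOn one_ne_zero) hs ht)
      (hasDerivWithinAt_partialT (hsu.differentiableOn one_ne_zero) hs ht) hq)
  rw [e1, e2, areaElement_eq hσ1 hp, partialS_partialT_comm hσ.contDiffOn hp,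
    partialS_partialT_comm hu.contDiffOn hp]
  exact connectionForm_curvature hJ (hσ.mem_sphere _ ⟨hs, ht⟩) (hu.unit _ ⟨hs, ht⟩)
    (hu.tangent _ ⟨hs, ht⟩)
    (dotProduct_deriv_self_eq_zero dσs hUs hs fun τ hτ => hσ.mem_sphere _ ⟨hτ, ht⟩)
    (dotProduct_deriv_self_eq_zero dσt hUt ht fun τ hτ => hσ.mem_sphere _ ⟨hs, hτ⟩)
    (dotProduct_deriv_self_eq_zero dus hUs hs fun τ hτ => hu.unit _ ⟨hτ, ht⟩)
    (dotProduct_deriv_self_eq_zero dut hUt ht fun τ hτ => hu.unit _ ⟨hs, hτ⟩)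
    (dotProduct_deriv_eq_zero dus dσs hUs hs fun τ hτ => hu.tangent _ ⟨hτ, ht⟩)
    (dotProduct_deriv_eq_zero dut dσt hUt ht fun τ hτ => hu.tangent _ ⟨hs, hτ⟩)

/-- By Green's theorem the phase integral over the disc is minus the integral of the connection form
along its boundary. The edges `t = 0` and `t = 1` cancel and the edge `s = 0` contributes nothing,
because the frame field descends to the disc. -/
theorem orientedSurfaceIntegral_phaseDensity (hJ : J.PosDef) (hσ : IsSpanningSurface T Γ σ)
    (hu : IsFrameField σ u) :
    orientedSurfaceIntegral (phaseDensity J) σ = -∫ t in (0 : ℝ)..1, connT J σ u (1, t) := by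
  have hg := green_unitSquare (contDiffOn_connS hJ hσ hu) (contDiffOn_connT hJ hσ hu)
  rw [setIntegral_congr_fun isOpen_openSquare.measurableSet fun p hp => curl_conn hJ hσ hu hp,
    integral_neg] at hg
  have hσ1 := hσ.contDiffOn.differentiableOn two_ne_zero
  have hu1 := hu.contDiffOn.differentiableOn two_ne_zero
  have h0 : (0 : ℝ) ∈ Icc (0 : ℝ) 1 := by simp
  have h1 : (1 : ℝ) ∈ Icc (0 : ℝ) 1 := by simp
  have hcentre : ∫ t in (0 : ℝ)..1, connT J σ u (0, t) = 0 := by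
    have hz : ∀ f : ℝ × ℝ → Vec, DifferentiableOn ℝ f closedSquare →
        (∃ c, ∀ t ∈ Icc (0 : ℝ) 1, f (0, t) = c) → ∀ t ∈ Icc (0 : ℝ) 1, partialT f (0, t) = 0 := by
      rintro f hf ⟨c, hc⟩ t ht
      exact (uniqueDiffOn_Icc_zero_one t ht).eq_deriv _ (hasDerivWithinAt_partialT hf h0 ht)
        ((hasDerivWithinAt_const t _ c).congr hc (hc t ht))
    rw [intervalIntegral.integral_congr (g := fun _ => 0)]
    · simp
    · intro t ht
      rw [uIcc_of_le zero_le_one] at ht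
      simp [connT, connectionForm, hz σ hσ1 hσ.centre t ht, hz u hu1 hu.centre t ht]
  have hedges : ∫ s in (0 : ℝ)..1, connS J σ u (s, 1) = ∫ s in (0 : ℝ)..1, connS J σ u (s, 0) := by
    have hz : ∀ f : ℝ × ℝ → Vec, DifferentiableOn ℝ f closedSquare →
        (∀ s ∈ Icc (0 : ℝ) 1, f (s, 0) = f (s, 1)) →
        ∀ s ∈ Icc (0 : ℝ) 1, partialS f (s, 1) = partialS f (s, 0) := by
      intro f hf h s hs
      exact (uniqueDiffOn_Icc_zero_one s hs).eq_deriv _ (hasDerivWithinAt_partialS hf hs h1)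
        ((hasDerivWithinAt_partialS hf hs h0).congr (fun τ hτ => (h τ hτ).symm) (h s hs).symm)
    refine intervalIntegral.integral_congr fun s hs => ?_
    rw [uIcc_of_le zero_le_one] at hs
    simp [connS, hz σ hσ1 hσ.glued s hs, hz u hu1 hu.glued s hs, hσ.glued s hs, hu.glued s hs]
  rw [hcentre, hedges] at hg
  rw [orientedSurfaceIntegral]
  linarith

end Disc

/-! ### Vertical rotations and the motion along the boundary -/

/-- The rotation by the angle `x` about the vertical axis. -/
noncomputable def rotz (x : ℝ) : Mat :=
  !![Real.cos x, -Real.sin x, 0; Real.sin x, Real.cos x, 0; 0, 0, 1]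

theorem rotz_add (x y : ℝ) : rotz (x + y) = rotz x * rotz y := by
  ext i j
  fin_cases i <;> fin_cases j <;>
    simp [rotz, Matrix.mul_apply, Fin.sum_univ_three, Real.cos_add, Real.sin_add] <;> ring

theorem rotz_zero : rotz 0 = 1 := by
  ext i j
  fin_cases i <;> fin_cases j <;> simp [rotz]

theorem rotz_transpose (x : ℝ) : (rotz x)ᵀ = rotz (-x) := by
  ext i j
  fin_cases i <;> fin_cases j <;> simp [rotz]

theorem exp_smul_hat_e3 (x : ℝ) : NormedSpace.exp (x • hat e3) = rotz x := by
  -- The exponential depends on the topology only; a norm is chosen in order to differentiate it.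
  let : NormedRing Mat := Matrix.linftyOpNormedRing
  let : NormedAlgebra ℝ Mat := Matrix.linftyOpNormedAlgebra
  have hrot : ∀ t : ℝ, HasDerivAt (fun τ => rotz (-τ)) (-(hat e3 * rotz (-t))) t := by
    intro t
    have hs : HasDerivAt (fun τ => Real.sin (-τ)) (-Real.cos (-t)) t := by
      simpa only [mul_neg_one] using (hasDerivAt_neg t).sin
    have hc : HasDerivAt (fun τ => Real.cos (-τ)) (Real.sin (-t)) t := by
      simpa only [neg_mul_neg, mul_one] using (hasDerivAt_neg t).cos
    refine hasDerivAt_pi.2 fun i => hasDerivAt_pi.2 fun j => ?_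
    fin_cases i <;> fin_cases j
    all_goals simp only [Fin.zero_eta, Fin.mk_one, Fin.reduceFinMk]
    · exact hc.congr_deriv (by simp [rotz, hat, e3])
    · exact hs.neg.congr_deriv (by simp [rotz, hat, e3])
    · exact (hasDerivAt_const t (0 : ℝ)).congr_deriv
        (by simp [rotz, hat, e3])
    · exact hs.congr_deriv (by simp [rotz, hat, e3])
    · exact hc.congr_deriv (by simp [rotz, hat, e3])
    · exact (hasDerivAt_const t (0 : ℝ)).congr_deriv
        (by simp [rotz, hat, e3])
    · exact (hasDerivAt_const t (0 : ℝ)).congr_deriv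
        (by simp [rotz, hat, e3])
    · exact (hasDerivAt_const t (0 : ℝ)).congr_deriv
        (by simp [rotz, hat, e3])
    · exact (hasDerivAt_const t (1 : ℝ)).congr_deriv
        (by simp [rotz, hat, e3])
  have hexp := fun t : ℝ => hasDerivAt_exp_smul_const (hat e3) t
  have hconst : ∀ t : ℝ, NormedSpace.exp (t • hat e3) * rotz (-t) = 1 := by
    intro t
    have h := is_const_of_deriv_eq_zero
      (f := fun t : ℝ => NormedSpace.exp (t • hat e3) * rotz (-t))
      (fun t => ((hexp t).mul (hrot t)).differentiableAt)
      (fun t => ((hexp t).mul (hrot t)).deriv.trans (by simp [mul_assoc])) t 0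
    simpa [rotz_zero] using h
  calc NormedSpace.exp (x • hat e3) = NormedSpace.exp (x • hat e3) * (rotz (-x) * rotz x) := by
        rw [← rotz_add, neg_add_cancel, rotz_zero, mul_one]
    _ = rotz x := by rw [← mul_assoc, hconst, one_mul]

theorem verticalRotation_eq (x : ℝ) (R : Mat) : verticalRotation x R = rotz x * R := by
  rw [verticalRotation, exp_smul_hat_e3]

theorem rotz_eq_iff {x y : ℝ} : rotz x = rotz y ↔ (x : Real.Angle) = y := by
  constructor
  · intro h
    have h0 := congrFun (congrFun h 0) 0
    have h1 := congrFun (congrFun h 1) 0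
    simp [rotz] at h0 h1
    exact Real.Angle.cos_sin_inj h0 h1
  · intro h
    have hc := congrArg Real.Angle.cos h
    have hs := congrArg Real.Angle.sin h
    simp only [Real.Angle.cos_coe, Real.Angle.sin_coe] at hc hs
    simp [rotz, hc, hs]

theorem reducedAttitude_eq (R : Mat) : reducedAttitude R = R 2 := by
  ext j
  simp [reducedAttitude, e3, mulVec, dotProduct, Fin.sum_univ_three]

/-- The stabilizer of the vertical direction in `SO(3)` consists of the vertical rotations. -/
theorem exists_eq_rotz {U : Mat} (hU : U ∈ specialOrthogonalGroup (Fin 3) ℝ)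
    (h : reducedAttitude U = e3) : ∃ x, U = rotz x := by
  rw [reducedAttitude_eq] at h
  obtain ⟨ho, hdet⟩ := mem_specialOrthogonalGroup_iff.1 hU
  have hUU := (mem_orthogonalGroup_iff (Fin 3) ℝ).1 ho
  have h20 : U 2 0 = 0 := by simpa [e3] using congrFun h 0
  have h21 : U 2 1 = 0 := by simpa [e3] using congrFun h 1
  have h22 : U 2 2 = 1 := by simpa [e3] using congrFun h 2
  have hent : ∀ i j, ∑ k, U i k * U j k = (1 : Mat) i j := fun i j => by
    rw [← hUU]; simp [Matrix.mul_apply]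
  have h02 : U 0 2 = 0 := by simpa [Fin.sum_univ_three, h20, h21, h22] using hent 0 2
  have h12 : U 1 2 = 0 := by simpa [Fin.sum_univ_three, h20, h21, h22] using hent 1 2
  have h00 := hent 0 0
  have h01 := hent 0 1
  have h11 := hent 1 1
  rw [det_fin_three] at hdet
  simp [Fin.sum_univ_three, h02, h12, h20, h21, h22] at h00 h01 h11 hdet
  have e1 : U 1 1 = U 0 0 := by linear_combination U 0 0 * hdet - U 1 1 * h00 + U 0 1 * h01
  have e2 : U 1 0 = -U 0 1 := by linear_combination (-U 0 1) * hdet - U 1 0 * h00 + U 0 0 * h01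
  set z : ℂ := ⟨U 0 0, -U 0 1⟩ with hz
  have hn : ‖z‖ = 1 := by
    rw [Complex.norm_def, Complex.normSq_mk, Real.sqrt_eq_one]
    linarith
  have hz0 : z ≠ 0 := by rw [← norm_ne_zero_iff, hn]; exact one_ne_zero
  have hc : Real.cos z.arg = U 0 0 := by rw [Complex.cos_arg hz0, hn]; simp [hz]
  have hs : Real.sin z.arg = -U 0 1 := by rw [Complex.sin_arg, hn]; simp [hz]
  refine ⟨z.arg, ?_⟩
  ext i j
  fin_cases i <;> fin_cases j <;> simp [rotz, hc, hs, e1, e2, h02, h12, h20, h21, h22]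

/-- The moving frame `(u, x ⨯₃ u, x)` of the sphere, as an attitude matrix. -/
def frameMatrix (x u : Vec) : Mat := Matrix.of ![u, x ⨯₃ u, x]

theorem frameMatrix_mul_transpose {x u : Vec} (hx : x ⬝ᵥ x = 1) (hu : u ⬝ᵥ u = 1)
    (hux : u ⬝ᵥ x = 0) : frameMatrix x u * (frameMatrix x u)ᵀ = 1 := by
  have hvv : (x ⨯₃ u) ⬝ᵥ (x ⨯₃ u) = 1 := by
    rw [cross_dot_cross, hx, hu, hux]; simp
  have h1 : u ⬝ᵥ (x ⨯₃ u) = 0 := dot_cross_self x u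
  have h2 : x ⬝ᵥ (x ⨯₃ u) = 0 := dot_self_cross x u
  ext i j
  change ![u, x ⨯₃ u, x] i ⬝ᵥ ![u, x ⨯₃ u, x] j = _
  fin_cases i <;> fin_cases j <;>
    simp [hu, hx, hux, hvv, h1, h2, dotProduct_comm (x ⨯₃ u), dotProduct_comm x u]

theorem frameMatrix_mem {x u : Vec} (hx : x ⬝ᵥ x = 1) (hu : u ⬝ᵥ u = 1)
    (hux : u ⬝ᵥ x = 0) : frameMatrix x u ∈ specialOrthogonalGroup (Fin 3) ℝ := by
  refine mem_specialOrthogonalGroup_iff.2 ⟨(mem_orthogonalGroup_iff (Fin 3) ℝ).2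
    (frameMatrix_mul_transpose hx hu hux), ?_⟩
  change det ![u, x ⨯₃ u, x] = 1
  rw [← triple_product_eq_det, cross_cross_eq_smul_sub_smul, hx]
  simp [hu, hux]

/-- If the frame field `v` is horizontal along the motion of `x`, then it is carried along by the
angular velocity that has vanishing vertical momentum. -/
theorem deriv_eq_cross_of_horizontal {J : Mat} (hJ : J.PosDef) {x v x' v' ω : Vec}
    (hx : x ⬝ᵥ x = 1) (hv : v ⬝ᵥ v = 1) (hvx : v ⬝ᵥ x = 0) (hvv' : v ⬝ᵥ v' = 0)
    (hvx' : v' ⬝ᵥ x + v ⬝ᵥ x' = 0) (hx' : x' = x ⨯₃ ω) (hμ : x ⬝ᵥ (J *ᵥ ω) = 0)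
    (hhor : connectionForm J x v x' v' = 0) : v' = v ⨯₃ ω := by
  have hq := dotProduct_mulVec_pos hJ hx
  have h1 : x' ⨯₃ x = ω - (x ⬝ᵥ ω) • x := by
    rw [hx', cross_cross_eq_smul_sub_smul, hx, one_smul, dotProduct_comm ω x]
  have h2 : v ⬝ᵥ (x ⨯₃ v') = x ⬝ᵥ ω := by
    rw [connectionForm, h1, dotProduct_sub, ← mulVec_dotProduct_comm hJ x ω, hμ, dotProduct_smul,
      dotProduct_comm (J *ᵥ x) x] at hhor
    field_simp at hhor
    simp only [smul_eq_mul] at hhor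
    exact mul_right_cancel₀ hq.ne' (by linarith)
  rw [eq_sum_orthonormal hv hx hvx v', eq_sum_orthonormal hv hx hvx (v ⨯₃ ω)]
  have a1 : v' ⬝ᵥ v = (v ⨯₃ ω) ⬝ᵥ v := by
    rw [dotProduct_comm, hvv', dotProduct_comm, dot_self_cross]
  have a2 : v' ⬝ᵥ (x ⨯₃ v) = (v ⨯₃ ω) ⬝ᵥ (x ⨯₃ v) := by
    rw [cross_dot_cross, hvx, hv, dotProduct_comm ω x, ← h2, triple_product_permutation v' x v,
      triple_product_permutation v x v', ← cross_anticomm v v',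
      dotProduct_neg]
    ring
  have a3 : v' ⬝ᵥ x = (v ⨯₃ ω) ⬝ᵥ x := by
    rw [eq_neg_of_add_eq_zero_left hvx', hx', dotProduct_comm _ x, triple_product_permutation x,
      ← cross_anticomm x ω, dotProduct_neg]
  rw [a1, a2, a3]

/-- Turning the frame field at the rate `ψ` adds `ψ` to the connection form. -/
theorem connectionForm_turn {J : Mat} {x u x' u' : Vec} (c s ψ : ℝ) (hcs : c ^ 2 + s ^ 2 = 1)
    (hx : x ⬝ᵥ x = 1) (hu : u ⬝ᵥ u = 1) (hux : u ⬝ᵥ x = 0) (huu' : u ⬝ᵥ u' = 0)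
    (hxx' : x ⬝ᵥ x' = 0) :
    connectionForm J x (c • u - s • (x ⨯₃ u)) x'
      ((-s * ψ) • u + c • u' - ((c * ψ) • (x ⨯₃ u) + s • (x' ⨯₃ u + x ⨯₃ u'))) =
      connectionForm J x u x' u' + ψ := by
  have hxu : x ⬝ᵥ u = 0 := by rw [dotProduct_comm, hux]
  have c1 : x ⨯₃ (x ⨯₃ u) = -u := by
    rw [cross_cross_eq_smul_sub_smul', hx, hxu]; simp
  have c2 : x ⨯₃ (x' ⨯₃ u) = 0 := by
    rw [cross_cross_eq_smul_sub_smul', hxu, dotProduct_comm x' x, hxx']; simp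
  have c3 : x ⨯₃ (x ⨯₃ u') = (x ⬝ᵥ u') • x - u' := by
    rw [cross_cross_eq_smul_sub_smul', hx]; simp
  have h1 : u ⬝ᵥ (x ⨯₃ u) = 0 := dot_cross_self x u
  have h1' : (x ⨯₃ u) ⬝ᵥ u = 0 := by rw [dotProduct_comm, h1]
  have h2 : (x ⨯₃ u) ⬝ᵥ x = 0 := by rw [dotProduct_comm, dot_self_cross]
  have hvv : (x ⨯₃ u) ⬝ᵥ (x ⨯₃ u) = 1 := by
    rw [cross_dot_cross, hx, hu, hux]; simp
  have h3 : (x ⨯₃ u) ⬝ᵥ (x ⨯₃ u') = 0 := by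
    rw [cross_dot_cross, hx, huu', hux]; simp
  have h4 : (x ⨯₃ u) ⬝ᵥ u' = -(u ⬝ᵥ (x ⨯₃ u')) := by
    rw [dotProduct_comm, triple_product_permutation u', triple_product_permutation x,
      ← cross_anticomm, dotProduct_neg]
  simp only [connectionForm, map_add, map_sub, map_smul, c1, c2, c3, dotProduct_add,
    dotProduct_sub, sub_dotProduct, smul_dotProduct, dotProduct_smul, dotProduct_neg, smul_eq_mul,
    h1, h1', h2, h3, h4, hu, hux, huu', hvv, dotProduct_zero]
  linear_combination (u ⬝ᵥ (x ⨯₃ u') + ψ) * hcs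

/-- Two vectors rotating with the same angular velocity keep their inner product. -/
theorem dotProduct_eq_of_deriv_eq_cross {x y ω : ℝ → Vec}
    (hx : ∀ t ∈ Icc (0 : ℝ) 1, HasDerivWithinAt x (x t ⨯₃ ω t) (Icc 0 1) t)
    (hy : ∀ t ∈ Icc (0 : ℝ) 1, HasDerivWithinAt y (y t ⨯₃ ω t) (Icc 0 1) t) :
    x 1 ⬝ᵥ y 1 = x 0 ⬝ᵥ y 0 := by
  have hd : ∀ t ∈ Icc (0 : ℝ) 1, HasDerivWithinAt (fun t => x t ⬝ᵥ y t) 0 (Icc 0 1) t := by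
    intro t ht
    convert hasDerivWithinAt_dotProduct (hx t ht) (hy t ht) using 1
    rw [dotProduct_comm _ (y t), triple_product_permutation (y t), ← cross_anticomm (y t) (ω t),
      dotProduct_neg, neg_add_cancel]
  exact constant_of_derivWithin_zero (fun t ht => (hd t ht).differentiableWithinAt)
    (fun t ht => (hd t (Ico_subset_Icc_self ht)).derivWithin
      (uniqueDiffOn_Icc_zero_one t (Ico_subset_Icc_self ht))) 1 (by simp)

section Motion

variable {J : Mat} {T : ℝ} {Γ : ℝ → Vec} {R : ℝ → Mat} {ω : ℝ → Vec} {σ u : ℝ × ℝ → Vec}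

theorem IsAttitudeMotion.hasDerivWithinAt_row (hT : 0 < T) (hR : IsAttitudeMotion T R ω) (i : Fin 3)
    {t : ℝ} (ht : t ∈ Icc (0 : ℝ) 1) :
    HasDerivWithinAt (fun τ => R (T * τ) i) (R (T * t) i ⨯₃ (T • ω (T * t))) (Icc 0 1) t := by
  have hmaps : MapsTo (fun τ => T * τ) (Icc 0 1) (Icc 0 T) := fun τ hτ =>
    ⟨mul_nonneg hT.le hτ.1, mul_le_of_le_one_right hT.le hτ.2⟩
  refine hasDerivWithinAt_pi.2 fun j => ?_
  have h := (hR.kinematics (T * t) (hmaps ht) i j).comp t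
    ((hasDerivWithinAt_id t (Icc 0 1)).const_mul T) hmaps
  refine h.congr_deriv ?_
  fin_cases j <;>
    simp [cross_apply, Matrix.mul_apply, hat, Fin.sum_univ_three] <;> ring

/-- Over a disc with frame field `u`, the attitude after one turn along the boundary is obtained by
integrating the connection form along it. -/
theorem attitude_eq_rotz_mul (hJ : J.PosDef) (hT : 0 < T) (hR : IsAttitudeMotion T R ω)
    (hΓ : ∀ t ∈ Icc 0 T, reducedAttitude (R t) = Γ t)
    (hμ : ∀ t ∈ Icc 0 T, momentumMap J (R t) (ω t) = 0)
    (hσ : IsSpanningSurface T Γ σ) (hu : IsFrameField σ u) :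
    R T = rotz (-∫ t in (0 : ℝ)..1, connT J σ u (1, t)) * R 0 := by
  have h1 : (1 : ℝ) ∈ Icc (0 : ℝ) 1 := by simp
  have h0 : (0 : ℝ) ∈ Icc (0 : ℝ) 1 := by simp
  have hmaps : MapsTo (fun τ => T * τ) (Icc 0 1) (Icc 0 T) := fun τ hτ =>
    ⟨mul_nonneg hT.le hτ.1, mul_le_of_le_one_right hT.le hτ.2⟩
  set x : ℝ → Vec := fun t => σ (1, t) with hx_def
  set w : ℝ → Vec := fun t => u (1, t) with hw_def
  set A : ℝ → ℝ := fun t => connT J σ u (1, t) with hA_def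
  -- The angle from the given frame field to the horizontal one.
  set φ : ℝ → ℝ := fun t => -∫ τ in (0 : ℝ)..t, A τ with hφ_def
  have hxR : ∀ t ∈ Icc (0 : ℝ) 1, x t = R (T * t) 2 := fun t ht => by
    exact (hσ.boundary t ht).trans ((hΓ _ (hmaps ht)).symm.trans (reducedAttitude_eq _))
  have hxx : ∀ t ∈ Icc (0 : ℝ) 1, x t ⬝ᵥ x t = 1 := fun t ht => hσ.mem_sphere _ ⟨h1, ht⟩
  have hww : ∀ t ∈ Icc (0 : ℝ) 1, w t ⬝ᵥ w t = 1 := fun t ht => hu.unit _ ⟨h1, ht⟩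
  have hwx : ∀ t ∈ Icc (0 : ℝ) 1, w t ⬝ᵥ x t = 0 := fun t ht => hu.tangent _ ⟨h1, ht⟩
  have dx : ∀ t ∈ Icc (0 : ℝ) 1, HasDerivWithinAt x (partialT σ (1, t)) (Icc 0 1) t :=
    fun t ht => hasDerivWithinAt_partialT (hσ.contDiffOn.differentiableOn two_ne_zero) h1 ht
  have dw : ∀ t ∈ Icc (0 : ℝ) 1, HasDerivWithinAt w (partialT u (1, t)) (Icc 0 1) t :=
    fun t ht => hasDerivWithinAt_partialT (hu.contDiffOn.differentiableOn two_ne_zero) h1 ht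
  have hAc : ContinuousOn A (Icc 0 1) := (contDiffOn_connT hJ hσ hu).continuousOn.comp
    (continuousOn_const.prodMk continuousOn_id) fun t ht => ⟨h1, ht⟩
  have dφ : ∀ t ∈ Icc (0 : ℝ) 1, HasDerivWithinAt φ (-A t) (Icc 0 1) t := by
    intro t ht
    have : Fact (t ∈ Icc (0 : ℝ) 1) := ⟨ht⟩
    refine (intervalIntegral.integral_hasDerivWithinAt_right ?_ (t := Icc 0 1) ?_ (hAc t ht)).neg
    · exact (hAc.mono (by rw [uIcc_of_le ht.1]; exact Icc_subset_Icc_right ht.2)).intervalIntegrable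
    · exact hAc.stronglyMeasurableAtFilter_nhdsWithin measurableSet_Icc t
  -- The horizontal frame field along the boundary curve.
  set v : ℝ → Vec := fun t => Real.cos (φ t) • w t - Real.sin (φ t) • (x t ⨯₃ w t) with hv_def
  have hvv : ∀ t ∈ Icc (0 : ℝ) 1, v t ⬝ᵥ v t = 1 := by
    intro t ht
    have e1 : (x t ⨯₃ w t) ⬝ᵥ (x t ⨯₃ w t) = 1 := by
      rw [cross_dot_cross, hxx t ht, hww t ht, hwx t ht]; simp
    have e2 : (x t ⨯₃ w t) ⬝ᵥ w t = 0 := by rw [dotProduct_comm, dot_cross_self]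
    simp only [hv_def, dotProduct_sub, sub_dotProduct, smul_dotProduct, dotProduct_smul,
      smul_eq_mul, hww t ht, e1, e2, dot_cross_self]
    linear_combination Real.cos_sq_add_sin_sq (φ t)
  have hvx : ∀ t ∈ Icc (0 : ℝ) 1, v t ⬝ᵥ x t = 0 := by
    intro t ht
    have e2 : (x t ⨯₃ w t) ⬝ᵥ x t = 0 := by rw [dotProduct_comm, dot_self_cross]
    simp [hv_def, hwx t ht, e2]
  have dx' : ∀ t ∈ Icc (0 : ℝ) 1,
      HasDerivWithinAt x (x t ⨯₃ (T • ω (T * t))) (Icc 0 1) t := by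
    intro t ht
    rw [hxR t ht]
    exact (hR.hasDerivWithinAt_row hT 2 ht).congr hxR (hxR t ht)
  have dv : ∀ t ∈ Icc (0 : ℝ) 1, HasDerivWithinAt v (v t ⨯₃ (T • ω (T * t))) (Icc 0 1) t := by
    intro t ht
    have hU := uniqueDiffOn_Icc_zero_one t ht
    have d := ((dφ t ht).cos.smul (dw t ht)).sub
      ((dφ t ht).sin.smul (hasDerivWithinAt_crossProduct (dx t ht) (dw t ht)))
    have hhor := connectionForm_turn (J := J) (Real.cos (φ t)) (Real.sin (φ t)) (-A t)
      (Real.cos_sq_add_sin_sq _) (hxx t ht) (hww t ht) (hwx t ht)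
      (dotProduct_deriv_self_eq_zero (dw t ht) hU ht hww)
      (dotProduct_deriv_self_eq_zero (dx t ht) hU ht hxx)
    have hμ' : x t ⬝ᵥ (J *ᵥ (T • ω (T * t))) = 0 := by
      have h := hμ _ (hmaps ht)
      rw [momentumMap, dotProduct_mulVec, ← mulVec_transpose] at h
      have e : x t = (R (T * t))ᵀ *ᵥ e3 := (hσ.boundary t ht).trans (hΓ _ (hmaps ht)).symm
      rw [e, mulVec_smul, dotProduct_smul, h, smul_zero]
    have d' : HasDerivWithinAt v _ (Icc 0 1) t := d
    refine d.congr_deriv ?_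
    refine deriv_eq_cross_of_horizontal hJ (hxx t ht) (hvv t ht) (hvx t ht)
      (dotProduct_deriv_self_eq_zero d' hU ht hvv)
      (dotProduct_deriv_eq_zero d' (dx t ht) hU ht hvx)
      (hU.eq_deriv _ (dx t ht) (dx' t ht)) hμ' ?_
    have e : connectionForm J (x t) (w t) (partialT σ (1, t)) (partialT u (1, t)) = A t := rfl
    rw [e, add_neg_cancel] at hhor
    rw [← hhor]
    congr 1
    module
  have hφ0 : φ 0 = 0 := by simp [hφ_def]
  have hv0 : v 0 = w 0 := by simp [hv_def, hφ0]
  have hw01 : w 1 = w 0 := (hu.glued 1 h1).symm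
  have hx01 : x 1 = x 0 := (hσ.glued 1 h1).symm
  -- All rows of the attitude and of the horizontal frame rotate with the same angular velocity.
  have hconst : R (T * 1) * (frameMatrix (x 1) (v 1))ᵀ =
      R (T * 0) * (frameMatrix (x 0) (v 0))ᵀ := by
    have hrow : ∀ j : Fin 3, ∀ t ∈ Icc (0 : ℝ) 1,
        HasDerivWithinAt (fun τ => frameMatrix (x τ) (v τ) j)
          (frameMatrix (x t) (v t) j ⨯₃ (T • ω (T * t))) (Icc 0 1) t := by
      intro j t ht
      fin_cases j
      · exact dv t ht
      · refine (hasDerivWithinAt_crossProduct (dx' t ht) (dv t ht)).congr_deriv ?_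
        change _ = (x t ⨯₃ v t) ⨯₃ _
        rw [cross_cross (x t) (v t), ← cross_anticomm (x t ⨯₃ _) (v t)]
        abel
      · exact dx' t ht
    ext i j
    exact dotProduct_eq_of_deriv_eq_cross (fun t ht => hR.hasDerivWithinAt_row hT i ht) (hrow j)
  rw [mul_one, mul_zero, hv0] at hconst
  set F := frameMatrix (x 0) (w 0) with hF
  have hF1 : frameMatrix (x 1) (v 1) = rotz (φ 1) * F := by
    have e : x 0 ⨯₃ (x 0 ⨯₃ w 0) = -w 0 := by
      rw [cross_cross_eq_smul_sub_smul', hxx 0 h0, dotProduct_comm (x 0), hwx 0 h0]; simp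
    rw [hv_def]
    simp only
    rw [hx01, hw01, hF]
    ext i j
    fin_cases i <;>
      simp [frameMatrix, rotz, Matrix.mul_apply, Fin.sum_univ_three, e] <;> ring
  have hFF := frameMatrix_mul_transpose (hxx 0 h0) (hww 0 h0) (hwx 0 h0)
  rw [← hF] at hFF
  have hFF' : Fᵀ * F = 1 := mul_eq_one_comm.1 hFF
  have hFmem := frameMatrix_mem (hxx 0 h0) (hww 0 h0) (hwx 0 h0)
  have hR0 := hR.mem_SO3 0 ⟨le_rfl, hT.le⟩
  -- `R 0 * Fᵀ` fixes the vertical direction, so it commutes with the vertical rotations.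
  obtain ⟨α, hα⟩ : ∃ α, R 0 * Fᵀ = rotz α := by
    refine exists_eq_rotz (mul_mem hR0 ?_) ?_
    · exact mem_specialOrthogonalGroup_iff.2 ⟨(mem_orthogonalGroup_iff (Fin 3) ℝ).2 hFF',
        (det_transpose F).trans (mem_specialOrthogonalGroup_iff.1 hFmem).2⟩
    · have e : R 0 2 = x 0 := by rw [hxR 0 h0, mul_zero]
      rw [reducedAttitude_eq]
      change R 0 2 ᵥ* Fᵀ = e3
      rw [vecMul_transpose, e]
      ext i
      change ![w 0, x 0 ⨯₃ w 0, x 0] i ⬝ᵥ x 0 = _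
      have h2 : (x 0 ⨯₃ w 0) ⬝ᵥ x 0 = 0 := by rw [dotProduct_comm, dot_self_cross]
      fin_cases i <;> simp [e3, hwx 0 h0, hxx 0 h0, h2]
  rw [hF1, transpose_mul, rotz_transpose, ← mul_assoc] at hconst
  change R T = rotz (φ 1) * R 0
  calc R T = R T * Fᵀ * rotz (-φ 1) * rotz (φ 1) * F := by
        rw [mul_assoc (R T * Fᵀ), ← rotz_add, neg_add_cancel, rotz_zero, mul_one, mul_assoc, hFF',
          mul_one]
    _ = rotz (φ 1) * R 0 := by
        rw [hconst, hα, ← rotz_add, add_comm, rotz_add, ← hα, mul_assoc, mul_assoc, hFF', mul_one]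

end Motion

/-! ### Surface integrals on the sphere -/

/-- Integration in polar coordinates of a function on the open unit ball that is constant on
rays. -/
theorem integral_radially_constant {h : EuclideanSpace ℝ (Fin 3) → ℝ} {F : Sphere → ℝ}
    (hin : ∀ (x : Sphere) (r : ℝ), 0 < r → r < 1 → h (r • (x : EuclideanSpace ℝ (Fin 3))) = F x)
    (hout : ∀ (x : Sphere) (r : ℝ), 1 ≤ r → h (r • (x : EuclideanSpace ℝ (Fin 3))) = 0) :
    ∫ y, h y = 1 / 3 * ∫ x, F x ∂sphereArea := by
  have hmp := (volume : Measure (EuclideanSpace ℝ (Fin 3))).measurePreserving_homeomorphUnitSphereProd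
  have hfin : Module.finrank ℝ (EuclideanSpace ℝ (Fin 3)) - 1 = 2 := by simp
  calc ∫ y, h y = ∫ y : ({0}ᶜ : Set (EuclideanSpace ℝ (Fin 3))), h y.1 
          ∂(volume.comap Subtype.val) := by
        rw [integral_subtype_comap (measurableSet_singleton _).compl h, restrict_compl_singleton]
    _ = ∫ p : Sphere × Ioi (0 : ℝ), h (p.2.1 • p.1.1)
          ∂(sphereArea.prod (Measure.volumeIoiPow 2)) := by
        rw [← hfin, sphereArea, ← hmp.integral_comp (Homeomorph.measurableEmbedding _)]
        refine integral_congr_ae (Filter.Eventually.of_forall fun y => ?_)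
        have e := congrArg Subtype.val
          ((homeomorphUnitSphereProd (EuclideanSpace ℝ (Fin 3))).symm_apply_apply y)
        rw [homeomorphUnitSphereProd_symm_apply_coe] at e
        exact congrArg h e.symm
    _ = ∫ p : Sphere × Ioi (0 : ℝ), F p.1 * (Iio (⟨1, mem_Ioi.2 one_pos⟩ : Ioi (0 : ℝ))).indicator 1 p.2
          ∂(sphereArea.prod (Measure.volumeIoiPow 2)) := by
        refine integral_congr_ae (Filter.Eventually.of_forall fun p => ?_)
        by_cases hp : p.2.1 < 1
        · have : p.2 ∈ Iio (⟨1, mem_Ioi.2 one_pos⟩ : Ioi (0 : ℝ)) := hp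
          simp [this, hin p.1 p.2.1 p.2.2 hp]
        · have : p.2 ∉ Iio (⟨1, mem_Ioi.2 one_pos⟩ : Ioi (0 : ℝ)) := hp
          simp [this, hout p.1 p.2.1 (not_lt.1 hp)]
    _ = 1 / 3 * ∫ x, F x ∂sphereArea := by
        have : IsFiniteMeasure sphereArea := by unfold sphereArea; infer_instance
        rw [integral_prod_mul F (fun r : Ioi (0 : ℝ) =>
            (Iio (⟨1, mem_Ioi.2 one_pos⟩ : Ioi (0 : ℝ))).indicator (1 : Ioi (0 : ℝ) → ℝ) r),
          integral_indicator_one measurableSet_Iio, measureReal_def,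
          Measure.volumeIoiPow_apply_Iio, ENNReal.toReal_ofReal (by norm_num)]
        norm_num
        ring

/-- The coordinates of `ℝ³` grouped as a radius and a point of the parameter square. -/
def coneCoord : Vec ≃ᵐ ℝ × (ℝ × ℝ) :=
  (MeasurableEquiv.piFinSuccAbove (fun _ => ℝ) 0).trans
    ((MeasurableEquiv.refl ℝ).prodCongr MeasurableEquiv.finTwoArrow)

theorem coneCoord_apply (x : Vec) : coneCoord x = (x 0, (x 1, x 2)) := rfl

theorem volume_preserving_coneCoord : MeasurePreserving coneCoord := by
  have h := (MeasurePreserving.id (volume : Measure ℝ)).prod (volume_preserving_finTwoArrow ℝ)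
  exact h.comp (volume_preserving_piFinSuccAbove (fun _ : Fin 3 => ℝ) 0)

/-- The cone over the parametrized surface `σ`. -/
def cone (σ : ℝ × ℝ → Vec) (x : Vec) : Vec := x 0 • σ (x 1, x 2)

/-- The part over `A` of the parameter domain of the cone of height one. -/
def coneBox (A : Set (ℝ × ℝ)) : Set Vec := coneCoord ⁻¹' (Ioo 0 1 ×ˢ A)

theorem mem_coneBox {A : Set (ℝ × ℝ)} {x : Vec} :
    x ∈ coneBox A ↔ x 0 ∈ Ioo (0 : ℝ) 1 ∧ (x 1, x 2) ∈ A := Iff.rfl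

theorem smul_eq_smul_of_unit {a b : ℝ} {x y : Vec} (ha : 0 < a) (hb : 0 < b) (hx : x ⬝ᵥ x = 1)
    (hy : y ⬝ᵥ y = 1) (h : a • x = b • y) : a = b ∧ x = y := by
  have h1 : a ^ 2 = b ^ 2 := by
    have := congrArg (fun v : Vec => v ⬝ᵥ v) h
    simp [hx, hy] at this
    nlinarith
  have hab : a = b := (pow_left_inj₀ ha.le hb.le two_ne_zero).1 h1
  subst hab
  exact ⟨rfl, smul_right_injective _ ha.ne' h⟩

/-- The derivative of the cone over `σ`. -/
noncomputable def coneDeriv (σ : ℝ × ℝ → Vec) (x : Vec) : Vec →L[ℝ] Vec :=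
  x 0 • (fderivWithin ℝ σ closedSquare (x 1, x 2)).comp
    ((ContinuousLinearMap.proj 1).prod (ContinuousLinearMap.proj 2)) +
    (ContinuousLinearMap.proj (R := ℝ) (φ := fun _ : Fin 3 => ℝ) 0).smulRight (σ (x 1, x 2))

theorem hasFDerivWithinAt_cone {σ : ℝ × ℝ → Vec} (hσ : DifferentiableOn ℝ σ closedSquare)
    {x : Vec} (hx : x ∈ coneBox closedSquare) :
    HasFDerivWithinAt (cone σ) (coneDeriv σ x) (coneBox closedSquare) x := by
  have h0 : HasFDerivWithinAt (fun y : Vec => y 0)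
      (ContinuousLinearMap.proj (R := ℝ) (φ := fun _ : Fin 3 => ℝ) 0)
      (coneBox closedSquare) x := hasFDerivWithinAt_apply 0 x _
  let L : Vec →L[ℝ] ℝ × ℝ := (ContinuousLinearMap.proj 1).prod (ContinuousLinearMap.proj 2)
  have h1 : HasFDerivWithinAt (fun y : Vec => (y 1, y 2)) L (coneBox closedSquare) x :=
    L.hasFDerivWithinAt
  have h2 := HasFDerivWithinAt.comp x (g := σ) (t := closedSquare)
    (hσ (x 1, x 2) hx.2).hasFDerivWithinAt h1 fun y hy => hy.2
  exact h0.smul h2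

/-- The columns of the derivative of the cone are `σ`, `r ∂ₛσ` and `r ∂ₜσ`. -/
theorem det_coneDeriv {σ : ℝ × ℝ → Vec} (x : Vec) :
    (coneDeriv σ x).det = x 0 ^ 2 * (σ (x 1, x 2) ⬝ᵥ
      (partialS σ (x 1, x 2) ⨯₃ partialT σ (x 1, x 2))) := by
  have e0 : coneDeriv σ x (Pi.single 0 1) = σ (x 1, x 2) := by
    have : ((0 : ℝ), (0 : ℝ)) = 0 := rfl
    simp [coneDeriv, this]
  have e1 : coneDeriv σ x (Pi.single 1 1) = x 0 • partialS σ (x 1, x 2) := by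
    simp [coneDeriv, partialS]
  have e2 : coneDeriv σ x (Pi.single 2 1) = x 0 • partialT σ (x 1, x 2) := by
    simp [coneDeriv, partialT]
  have hM : LinearMap.toMatrix' (coneDeriv σ x : Vec →ₗ[ℝ] Vec) =
      (Matrix.of ![σ (x 1, x 2), x 0 • partialS σ (x 1, x 2), x 0 • partialT σ (x 1, x 2)])ᵀ := by
    ext i j
    rw [LinearMap.toMatrix'_apply]
    fin_cases j
    · exact congrFun e0 i
    · exact congrFun e1 i
    · exact congrFun e2 i
  rw [ContinuousLinearMap.det, ← LinearMap.det_toMatrix', hM, det_transpose]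
  change det ![_, _, _] = _
  rw [← triple_product_eq_det]
  simp
  ring

theorem volume_coneBox_edges : volume (coneBox (closedSquare \ openSquare)) = 0 := by
  rw [coneBox, volume_preserving_coneCoord.measure_preimage_equiv, Measure.volume_eq_prod,
    Measure.prod_prod]
  have : volume (closedSquare \ openSquare) = 0 :=
    ae_le_set.1 (Measure.set_prod_ae_eq (μ := volume) (ν := volume)
      Ioo_ae_eq_Icc Ioo_ae_eq_Icc).symm.le
  rw [this, mul_zero]

/-- For a positively embedded disc, both notions of integral agree: the change of variables is
carried out in the cone over the disc, where it is the change of variables formula of `ℝ³`. -/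
theorem sphereIntegral_surfaceImage {T : ℝ} {Γ : ℝ → Vec} {σ : ℝ × ℝ → Vec}
    (hσ : IsSpanningSurface T Γ σ) (hpos : IsPositivelyEmbedded σ) (f : Vec → ℝ) :
    sphereIntegral f (surfaceImage σ) = orientedSurfaceIntegral f σ := by
  have hσ1 := hσ.contDiffOn.differentiableOn two_ne_zero
  have hsub : coneBox openSquare ⊆ coneBox closedSquare := fun x hx =>
    ⟨hx.1, openSquare_subset hx.2⟩
  have hbox : MeasurableSet (coneBox openSquare) :=
    coneCoord.measurable (measurableSet_Ioo.prod isOpen_openSquare.measurableSet)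
  have hderiv : ∀ x ∈ coneBox openSquare,
      HasFDerivWithinAt (cone σ) (coneDeriv σ x) (coneBox openSquare) x := fun x hx =>
    (hasFDerivWithinAt_cone hσ1 (hsub hx)).mono hsub
  have hinj : InjOn (cone σ) (coneBox openSquare) := by
    intro x hx y hy hxy
    obtain ⟨h0, h1⟩ := smul_eq_smul_of_unit hx.1.1 hy.1.1
      (hσ.mem_sphere _ (openSquare_subset hx.2)) (hσ.mem_sphere _ (openSquare_subset hy.2)) hxy
    have h2 := hpos.injOn hx.2 hy.2 h1
    exact coneCoord.injective (Prod.ext h0 h2)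
  have hnull : volume (cone σ '' coneBox (closedSquare \ openSquare)) = 0 :=
    addHaar_image_eq_zero_of_differentiableOn_of_addHaar_eq_zero _
      (fun x hx => ((hasFDerivWithinAt_cone hσ1 ⟨hx.1, hx.2.1⟩).mono
        fun y hy => ⟨hy.1, hy.2.1⟩).differentiableWithinAt) volume_coneBox_edges
  have hae : cone σ '' coneBox openSquare =ᵐ[volume] cone σ '' coneBox closedSquare := by
    refine Filter.EventuallyLE.antisymm (image_mono hsub).eventuallyLE (ae_le_set.2 ?_)
    refine measure_mono_null ?_ hnull
    rintro _ ⟨⟨x, hx, rfl⟩, hx'⟩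
    exact ⟨x, ⟨hx.1, hx.2, fun h => hx' ⟨x, ⟨hx.1, h⟩, rfl⟩⟩, rfl⟩
  have hmeas : MeasurableSet (cone σ '' coneBox openSquare) :=
    measurable_image_of_fderivWithin hbox hderiv hinj
  have hmeas' : NullMeasurableSet (cone σ '' coneBox closedSquare) :=
    hmeas.nullMeasurableSet.congr hae
  have hB : MeasurableSet (surfaceImage σ) := by
    have h1 : IsClosed (σ '' closedSquare) :=
      (isCompact_closedSquare.image_of_continuousOn hσ.contDiffOn.continuousOn).isClosed
    exact (h1.preimage ((PiLp.continuous_ofLp 2 _).comp continuous_subtype_val)).measurableSet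
  -- The extension of `f` from the unit sphere that is constant on rays.
  let g : Vec → ℝ := fun v => f ((Real.sqrt (v ⬝ᵥ v))⁻¹ • v)
  have hg : ∀ (r : ℝ) (v : Vec), 0 < r → v ⬝ᵥ v = 1 → g (r • v) = f v := by
    intro r v hr hv
    have : Real.sqrt ((r • v) ⬝ᵥ (r • v)) = r := by
      rw [smul_dotProduct, dotProduct_smul, hv]
      simp [hr.le]
    simp only [g]
    rw [this, smul_smul, inv_mul_cancel₀ hr.ne', one_smul]
  have hunit : ∀ x : Sphere, WithLp.ofLp x.1 ⬝ᵥ WithLp.ofLp x.1 = 1 := by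
    intro x
    have h := EuclideanSpace.real_norm_sq_eq x.1
    rw [norm_eq_of_mem_sphere x] at h
    simp only [dotProduct, ← sq]
    linarith
  have hpolar := integral_radially_constant
    (h := fun y => (cone σ '' coneBox closedSquare).indicator g (WithLp.ofLp y))
    (F := (surfaceImage σ).indicator fun x => f (WithLp.ofLp x.1)) ?_ ?_
  · have hcov : ∫ v in cone σ '' coneBox openSquare, g v =
        1 / 3 * orientedSurfaceIntegral f σ := by
      rw [integral_image_eq_integral_abs_det_fderiv_smul volume hbox hderiv hinj]
      calc ∫ x in coneBox openSquare, |(coneDeriv σ x).det| • g (cone σ x)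
          = ∫ x in coneBox openSquare, (fun z : ℝ × (ℝ × ℝ) =>
              z.1 ^ 2 * (f (σ z.2) * areaElement σ z.2)) (coneCoord x) := by
            refine setIntegral_congr_fun hbox fun x hx => ?_
            have hx2 : (x 1, x 2) ∈ openSquare := hx.2
            have hA := hpos.areaElement_nonneg _ hx2
            simp only
            rw [det_coneDeriv, coneCoord_apply, ← areaElement_eq hσ1 hx2, abs_of_nonneg
              (mul_nonneg (sq_nonneg _) hA), cone, hg (x 0) (σ (x 1, x 2)) hx.1.1
              (hσ.mem_sphere _ (openSquare_subset hx2)), smul_eq_mul]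
            simp only
            ring
        _ = ∫ z in Ioo (0 : ℝ) 1 ×ˢ openSquare, z.1 ^ 2 * (f (σ z.2) * areaElement σ z.2) :=
            volume_preserving_coneCoord.setIntegral_preimage_emb coneCoord.measurableEmbedding
              (fun z : ℝ × (ℝ × ℝ) => z.1 ^ 2 * (f (σ z.2) * areaElement σ z.2)) _
        _ = _ := by
            rw [Measure.volume_eq_prod, setIntegral_prod_mul (fun r : ℝ => r ^ 2)
                (fun p : ℝ × ℝ => f (σ p) * areaElement σ p),
              orientedSurfaceIntegral, ← integral_Ioc_eq_integral_Ioo,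
              ← intervalIntegral.integral_of_le zero_le_one, integral_pow]
            norm_num
    have hvec : ∫ y : EuclideanSpace ℝ (Fin 3),
        (cone σ '' coneBox closedSquare).indicator g (WithLp.ofLp y) =
          ∫ v in cone σ '' coneBox openSquare, g v := by
      rw [setIntegral_congr_set hae, ← integral_indicator₀ hmeas']
      exact (EuclideanSpace.volume_preserving_symm_measurableEquiv_toLp (Fin 3)).integral_comp
        (MeasurableEquiv.measurableEmbedding _) _
    rw [hvec, hcov, integral_indicator hB] at hpolar
    rw [sphereIntegral]
    linarith
  · intro x r hr hr1
    by_cases hx : x ∈ surfaceImage σ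
    · obtain ⟨p, hp, hpx⟩ := id hx
      have hmem : WithLp.ofLp (r • x.1) ∈ cone σ '' coneBox closedSquare :=
        ⟨![r, p.1, p.2], mem_coneBox.2 ⟨⟨hr, hr1⟩, hp⟩, by simp [cone, hpx]⟩
      rw [indicator_of_mem hmem, indicator_of_mem hx, WithLp.ofLp_smul,
        hg r _ hr (hunit x)]
    · rw [indicator_of_notMem hx, indicator_of_notMem]
      rintro ⟨y, hy, hyx⟩
      obtain ⟨-, h⟩ := smul_eq_smul_of_unit hy.1.1 hr (hσ.mem_sphere _ hy.2) (hunit x) hyx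
      exact hx ⟨_, hy.2, h⟩
  · intro x r hr
    rw [indicator_of_notMem]
    rintro ⟨y, hy, hyx⟩
    obtain ⟨h, -⟩ := smul_eq_smul_of_unit hy.1.1 (by linarith) (hσ.mem_sphere _ hy.2) (hunit x) hyx
    exact absurd hy.1.2 (by linarith)

end Pendulum3D


theorem mainTheorem9 (J : Pendulum3D.Mat) (hJ : J.PosDef) (T : ℝ) (hT : 0 < T)
    (Γ : ℝ → Pendulum3D.Vec) (hclosed : Γ 0 = Γ T)
    (R : ℝ → Pendulum3D.Mat) (ω : ℝ → Pendulum3D.Vec)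
    (hR : Pendulum3D.IsAttitudeMotion T R ω)
    (hΓ : ∀ t ∈ Set.Icc 0 T, Pendulum3D.reducedAttitude (R t) = Γ t)
    (hμ : ∀ t ∈ Set.Icc 0 T, Pendulum3D.momentumMap J (R t) (ω t) = 0) :
    ∃ θ : Real.Angle,
      (∀ φ : Real.Angle, Pendulum3D.IsRotationAngle T R φ ↔ φ = θ) ∧
      ∀ σ : ℝ × ℝ → Pendulum3D.Vec, Pendulum3D.IsSpanningSurface T Γ σ →
        θ = ((Pendulum3D.orientedSurfaceIntegral (Pendulum3D.phaseDensity J) σ : ℝ) : Real.Angle) ∧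
        (Pendulum3D.IsPositivelyEmbedded σ →
          θ = ((Pendulum3D.sphereIntegral (Pendulum3D.phaseDensity J)
            (Pendulum3D.surfaceImage σ) : ℝ) : Real.Angle)) := by
  open Pendulum3D in
  have h0 : (0 : ℝ) ∈ Icc 0 T := ⟨le_rfl, hT.le⟩
  have h1 : T ∈ Icc 0 T := ⟨hT.le, le_rfl⟩
  have hR0 := hR.mem_SO3 0 h0
  have hRR : R 0 * (R 0)ᵀ = 1 :=
    (mem_orthogonalGroup_iff (Fin 3) ℝ).1 (mem_specialOrthogonalGroup_iff.1 hR0).1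
  have hRR' : (R 0)ᵀ * R 0 = 1 := mul_eq_one_comm.1 hRR
  have hR0' : (R 0)ᵀ ∈ specialOrthogonalGroup (Fin 3) ℝ :=
    mem_specialOrthogonalGroup_iff.2 ⟨(mem_orthogonalGroup_iff (Fin 3) ℝ).2 hRR',
      (det_transpose (R 0)).trans (mem_specialOrthogonalGroup_iff.1 hR0).2⟩
  -- `R T * (R 0)ᵀ` fixes the vertical direction because the reduced curve is closed.
  obtain ⟨α, hα⟩ : ∃ α, R T * (R 0)ᵀ = rotz α := by
    refine exists_eq_rotz (mul_mem (hR.mem_SO3 T h1) hR0') ?_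
    have e : (R T)ᵀ *ᵥ e3 = (R 0)ᵀ *ᵥ e3 :=
      (hΓ T h1).trans (hclosed.symm.trans (hΓ 0 h0).symm)
    rw [reducedAttitude, transpose_mul, transpose_transpose, ← mulVec_mulVec, e, mulVec_mulVec,
      hRR, one_mulVec]
  have hiff : ∀ x : ℝ, R T = rotz x * R 0 ↔ (x : Real.Angle) = α := by
    intro x
    rw [← rotz_eq_iff, ← hα]
    constructor
    · intro h
      rw [h, mul_assoc, hRR, mul_one]
    · intro h
      rw [h, mul_assoc, hRR', mul_one]
  refine ⟨α, fun φ => ?_, fun σ hσ => ?_⟩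
  · constructor
    · rintro ⟨x, rfl, hx⟩
      rw [verticalRotation_eq] at hx
      exact (hiff x).1 hx
    · rintro rfl
      exact ⟨α, rfl, by rw [verticalRotation_eq]; exact (hiff α).2 rfl⟩
  · obtain ⟨u, hu⟩ := hσ.exists_frameField
    have hphase : (α : Real.Angle) =
        ((orientedSurfaceIntegral (phaseDensity J) σ : ℝ) : Real.Angle) := by
      rw [orientedSurfaceIntegral_phaseDensity hJ hσ hu]
      exact ((hiff _).1 (attitude_eq_rotz_mul hJ hT hR hΓ hμ hσ hu)).symm
    exact ⟨hphase, fun hpos => by rw [sphereIntegral_surfaceImage hσ hpos]; exact hphase⟩
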